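/- Let $\Lambda$ be the von Mangoldt function and $\psi(u)=\sum_{n\le u}\Lambda(n)$. For an integer $k\ge 1$ put $$P_k(y)=\sum_{r=1}^{k} S(k,r)\,2^r\,r!\,y^r ,$$ where $S(k,r)$ is the Stirling number of the second kind, that is, the number of partitions of a set of $k$ elements into $r$ non-empty subsets. Let $k\ge 2$ be an integer, let $\omega>1$, $\epsilon>0$ and $\delta>0$ be real numbers, and let $f$ be a real function with $f(X)\to+\infty$ (arbitrarily slowly) as $X\to+\infty$. Then there is $X_0=X_0(k,\omega,\epsilon,\delta,f)$ such that, for all real $X\ge X_0$ and all real $h$ with $f(X)\le h\le X^{1-\delta}$, $$\sum_{\substack{p\le X\\ p\ \mathrm{prime}}}\bigl(\psi(p+h)-\psi(p)\bigr)^k\;\le\;\Bigl(P_{k+1}\Bigl(\frac{\omega h}{\log X}\Bigr)+\epsilon\Bigr)\,\frac{X}{h(\omega-1)}\,\log^{k}X .$$ -/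

import Mathlib

/-- The polynomial `P_k(y) = ∑_{r=1}^k S(k,r) 2^r r! y^r`, where `S(k,r)` is the Stirling number
of the second kind (the number of partitions of a `k`-element set into `r` non-empty blocks). -/
noncomputable def momentPoly (k : ℕ) (y : ℝ) : ℝ :=
  ∑ r ∈ Finset.Icc 1 k, (Nat.stirlingSecond k r : ℝ) * 2 ^ r * (Nat.factorial r : ℝ) * y ^ r

/-- The `k`-th moment over primes: the sum of `(ψ(p+h) - ψ(p))^k` over all primes `p ≤ X`,
where `ψ` is the Chebyshev function. -/
noncomputable def primeMoment (k : ℕ) (X h : ℝ) : ℝ :=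
  ∑ p ∈ Finset.Icc 1 ⌊X⌋₊ with Nat.Prime p,
    (Chebyshev.psi ((p : ℝ) + h) - Chebyshev.psi (p : ℝ)) ^ k

/-!
The bound holds with room to spare, and no integration over short intervals is needed: already the
left-hand side is at most `4 (X / h) log ^ k X` times
`∑_{r = 1}^{k} S(k, r) 2 ^ (r + 1) (r + 1)! y ^ (r + 1)`, where `y = h / log X`
(`PrimeMoment.exists_primeMoment_le`). As `S(k + 1, r + 1) ≥ S(k, r)` and `ω ^ m ≥ 4 (ω - 1)` for
`m ≥ 2`, this is at most the claimed right-hand side (`PrimeMoment.four_mul_le_momentPoly`).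

Expanding the `k`-th power of the number of primes in `(p, p + h]` into falling factorials with
Stirling numbers reduces the claim to counting, for each `r ≤ k`, the primes `p ≤ X` with
`p + d₁, …, p + d_r` prime, summed over distinct `d_i ≤ h`. Proper prime powers contribute only
`O(X ^ (1/2))` up to powers of `h` and `log X`, which the term of top degree absorbs
(`PrimeMoment.primeMoment_succ_le`). Put `n = r + 1`.

For one tuple, the primes up to a constant `W` are handled by splitting `p` into residue classes
modulo `P = ∏_{q ≤ W} q`, and Selberg's sieve (`PrimeMoment.selberg_sieve`) is applied in each
class with the primes of `(W, X ^ σ]` modulo which the tuple stays distinct, `σ` slightly below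
`1 / 2`. There the density is exactly `n / q`, and the sieve returns `(X / P) / J` with
`J = ∑ ∏_{q ∣ l} n / (q - n)`. A convolution inequality (`PrimeMoment.sum_inv_mul_selbergSum_le`)
bounds `J` below by sums over `n`-tuples of integers coprime to `P`, and a cut into logarithmic
blocks gives `J ≥ (1 - o(1)) (φ(P) / P) ^ n (σ log X) ^ n / n!`
(`PrimeMoment.choose_mul_pow_le_selbergSum`). This is where `2 ^ n n!` comes from.

The primes `q > W` dividing differences of the tuple cost an Euler factor, whose average over the
tuples is close to `1` because `∑_{q > W} q ^ (-2) ≤ 1 / W` is small compared with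
`φ(P) / P ≫ W ^ (-1/2)` (`PrimeMoment.sum_diffWeight_insert_le`, `PrimeMoment.exists_modulus`).
Tuples are built one element at a time; each new element ranges over the `d ≤ h` with `a + d`
coprime to `P`, of which there are about `φ(P) h / P` once `h` is large in terms of `P`. That is the
only use of `h → ∞`, and the powers of `φ(P) / P` then cancel against those in `J`.
-/

/-! ### Selberg's sieve -/

namespace PrimeMoment

open Finset

section Selberg

variable {ι : Type*} {g : ι → ℝ} {D : Finset (Finset ι)}

theorem sum_prod_pos (hg : ∀ p, (∃ s ∈ D, p ∈ s) → 0 < g p) (h0 : ∅ ∈ D) :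
    0 < ∑ u ∈ D, ∏ p ∈ u, g p :=
  sum_pos (fun u hu => prod_pos fun p hp => hg p ⟨u, hu, hp⟩) ⟨∅, h0⟩

variable [DecidableEq ι]

theorem sum_Icc_neg_one_pow {d u : Finset ι} (hdu : d ⊆ u) :
    ∑ s ∈ Icc d u, (-1 : ℝ) ^ #s = if d = u then (-1) ^ #d else 0 := by
  have h1 : ∑ s ∈ Icc d u, (-1 : ℝ) ^ #s
      = ∑ t ∈ (u \ d).powerset, (-1 : ℝ) ^ #d * (-1) ^ #t := by
    rw [Icc_eq_image_powerset hdu, sum_image]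
    · refine sum_congr rfl fun t ht => ?_
      rw [card_union_of_disjoint, pow_add]
      exact disjoint_of_subset_right (mem_powerset.1 ht) disjoint_sdiff
    · intro t ht t' ht' h
      have key : ∀ t ∈ (u \ d).powerset, (d ∪ t) \ d = t := fun t ht => by
        rw [union_sdiff_left]
        exact sdiff_eq_self_of_disjoint
          (disjoint_of_subset_left (mem_powerset.1 ht) sdiff_disjoint)
      rw [← key t ht, ← key t' ht']
      exact congrArg (· \ d) h
  rw [h1, ← mul_sum]
  have h2 : ∑ t ∈ (u \ d).powerset, (-1 : ℝ) ^ #t = if u \ d = ∅ then 1 else 0 := by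
    exact_mod_cast congrArg (Int.cast : ℤ → ℝ) (sum_powerset_neg_one_pow_card (x := u \ d))
  rw [h2]
  by_cases h : d = u
  · simp [h]
  · have : u \ d ≠ ∅ := fun h' => h (hdu.antisymm (sdiff_eq_empty_iff_subset.1 h'))
    simp [h, this]

/-- The weights `λ_s` of Selberg's sieve for a family `D` of finite sets of primes (each standing
for the squarefree product of its elements), with local density `g p / (1 + g p)` at `p`. -/
noncomputable def selbergWeight (g : ι → ℝ) (D : Finset (Finset ι)) (s : Finset ι) : ℝ :=
  (-1) ^ #s * (∏ p ∈ s, (1 + g p) / g p) * (∑ u ∈ D with s ⊆ u, ∏ p ∈ u, g p)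
    / ∑ u ∈ D, ∏ p ∈ u, g p

theorem selbergWeight_empty (hg : ∀ p, (∃ s ∈ D, p ∈ s) → 0 < g p) (h0 : ∅ ∈ D) :
    selbergWeight g D ∅ = 1 := by
  simp [selbergWeight, (sum_prod_pos hg h0).ne']

/-- A cruder bound than the classical `|λ_s| ≤ 1`, but enough for the remainder term and immediate
from the support of `D`. -/
theorem abs_selbergWeight_le (hg : ∀ p, (∃ s ∈ D, p ∈ s) → 0 < g p) (h0 : ∅ ∈ D)
    (hD : ∀ s ∈ D, ∀ t ⊆ s, t ∈ D) {s : Finset ι} (hs : s ∈ D) :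
    |selbergWeight g D s| ≤ ∏ p ∈ s, (1 + g p) := by
  have hJ := sum_prod_pos hg h0
  have hgs : ∀ p ∈ s, 0 < g p := fun p hp => hg p ⟨s, hs, hp⟩
  have hF : 0 < ∏ p ∈ s, (1 + g p) / g p :=
    prod_pos fun p hp => div_pos (by linarith [hgs p hp]) (hgs p hp)
  have hnn : ∀ u ∈ D, 0 ≤ ∏ p ∈ u, g p :=
    fun u hu => prod_nonneg fun p hp => (hg p ⟨u, hu, hp⟩).le
  have h1 : ∑ u ∈ D with s ⊆ u, ∏ p ∈ u, g p ≤ (∏ p ∈ s, g p) * ∑ u ∈ D, ∏ p ∈ u, g p := by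
    calc ∑ u ∈ D with s ⊆ u, ∏ p ∈ u, g p
        = ∑ u ∈ D with s ⊆ u, (∏ p ∈ s, g p) * ∏ p ∈ u \ s, g p := by
          refine sum_congr rfl fun u hu => ?_
          rw [mul_comm, prod_sdiff (mem_filter.1 hu).2]
      _ = (∏ p ∈ s, g p) * ∑ v ∈ (D.filter (s ⊆ ·)).image (· \ s), ∏ p ∈ v, g p := by
          rw [← mul_sum, sum_image]
          intro u hu v hv h
          have hu' := (mem_filter.1 hu).2
          have hv' := (mem_filter.1 hv).2
          rw [← sdiff_union_of_subset hu', ← sdiff_union_of_subset hv']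
          exact congrArg (· ∪ s) h
      _ ≤ _ := by
          refine mul_le_mul_of_nonneg_left ?_ (prod_nonneg fun p hp => (hgs p hp).le)
          refine sum_le_sum_of_subset_of_nonneg ?_ fun u hu _ => hnn u hu
          intro v hv
          obtain ⟨u, hu, rfl⟩ := mem_image.1 hv
          exact hD u (mem_filter.1 hu).1 _ sdiff_subset
  have h2 : 0 ≤ ∑ u ∈ D with s ⊆ u, ∏ p ∈ u, g p :=
    sum_nonneg fun u hu => hnn u (mem_filter.1 hu).1
  rw [selbergWeight, abs_div, abs_mul, abs_mul, abs_pow, abs_neg, abs_one, one_pow, one_mul,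
    abs_of_pos hF, abs_of_nonneg h2, abs_of_pos hJ, div_le_iff₀ hJ]
  calc _ ≤ (∏ p ∈ s, (1 + g p) / g p) * ((∏ p ∈ s, g p) * ∑ u ∈ D, ∏ p ∈ u, g p) :=
        mul_le_mul_of_nonneg_left h1 hF.le
    _ = _ := by
        rw [← mul_assoc, ← prod_mul_distrib]
        congr 1
        exact prod_congr rfl fun p hp => div_mul_cancel₀ _ (hgs p hp).ne'

/-- The linear change of variables that diagonalises Selberg's quadratic form. -/
theorem sum_selbergWeight_diag (hg : ∀ p, (∃ s ∈ D, p ∈ s) → 0 < g p)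
    (hD : ∀ s ∈ D, ∀ t ⊆ s, t ∈ D) {d : Finset ι} (hd : d ∈ D) :
    ∑ s ∈ D with d ⊆ s, selbergWeight g D s * ∏ p ∈ s, g p / (1 + g p)
      = (-1) ^ #d * (∏ p ∈ d, g p) / ∑ u ∈ D, ∏ p ∈ u, g p := by
  have h1 : ∀ s ∈ D.filter (d ⊆ ·), selbergWeight g D s * ∏ p ∈ s, g p / (1 + g p)
      = (∑ u ∈ D, if s ⊆ u then (-1) ^ #s * ∏ p ∈ u, g p else 0)
        / ∑ u ∈ D, ∏ p ∈ u, g p := by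
    intro s hs
    have hsD := (mem_filter.1 hs).1
    have : (∏ p ∈ s, (1 + g p) / g p) * ∏ p ∈ s, g p / (1 + g p) = 1 := by
      rw [← prod_mul_distrib]
      refine prod_eq_one fun p hp => ?_
      have := hg p ⟨s, hsD, hp⟩
      field_simp
    rw [selbergWeight, ← sum_filter, ← mul_sum, div_mul_eq_mul_div]
    congr 1
    linear_combination ((-1 : ℝ) ^ #s * ∑ u ∈ D with s ⊆ u, ∏ p ∈ u, g p) * this
  rw [sum_congr rfl h1, ← sum_div]
  congr 1
  rw [sum_comm]
  have h2 : ∀ u ∈ D, (∑ s ∈ D with d ⊆ s, if s ⊆ u then (-1 : ℝ) ^ #s * ∏ p ∈ u, g p else 0)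
      = if d = u then (-1) ^ #d * ∏ p ∈ d, g p else 0 := by
    intro u hu
    rw [← sum_filter, filter_filter]
    have : D.filter (fun s => d ⊆ s ∧ s ⊆ u) = Icc d u := by
      ext s
      simp only [mem_filter, mem_Icc]
      exact ⟨fun h => h.2, fun h => ⟨hD u hu s h.2, h⟩⟩
    rw [this, ← sum_mul]
    by_cases hdu : d ⊆ u
    · rw [sum_Icc_neg_one_pow hdu]
      split_ifs with h
      · rw [h]
      · simp
    · have hne : d ≠ u := fun h => hdu (h ▸ subset_rfl)
      rw [Icc_eq_empty (by simpa using hdu)]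
      simp [hne]
  rw [sum_congr rfl h2, sum_ite_eq, if_pos hd]

/-- The density at `s ∪ t` is the product of the densities at `s` and `t` divided by the density
at `s ∩ t`, and the latter reciprocal is a sum over the subsets of `s ∩ t`. -/
theorem prod_union_eq_sum_diag {s t : Finset ι} (hs : ∀ p ∈ s, 0 < g p) :
    ∏ p ∈ s ∪ t, g p / (1 + g p)
      = ∑ d ∈ (s ∩ t).powerset, (∏ p ∈ d, (g p)⁻¹) *
        ((∏ p ∈ s, g p / (1 + g p)) * ∏ p ∈ t, g p / (1 + g p)) := by
  rw [← sum_mul, ← prod_one_add, ← prod_union_inter, mul_comm (∏ p ∈ s ∪ t, _), ← mul_assoc,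
    ← prod_mul_distrib]
  have h1 : ∏ p ∈ s ∩ t, (1 + (g p)⁻¹) * (g p / (1 + g p)) = 1 := by
    refine prod_eq_one fun p hp => ?_
    have := hs p (mem_inter.1 hp).1
    field_simp
    ring
  rw [h1, one_mul]

/-- Selberg's quadratic form takes the value `1 / J` at the weights `selbergWeight`. -/
theorem sum_sum_selbergWeight (hg : ∀ p, (∃ s ∈ D, p ∈ s) → 0 < g p) (h0 : ∅ ∈ D)
    (hD : ∀ s ∈ D, ∀ t ⊆ s, t ∈ D) :
    ∑ s ∈ D, ∑ t ∈ D, selbergWeight g D s * selbergWeight g D t * ∏ p ∈ s ∪ t, g p / (1 + g p)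
      = 1 / ∑ u ∈ D, ∏ p ∈ u, g p := by
  set Λ := selbergWeight g D
  set F : Finset ι → ℝ := fun s => ∏ p ∈ s, g p / (1 + g p)
  set J := ∑ u ∈ D, ∏ p ∈ u, g p with hJdef
  have hJ : 0 < J := sum_prod_pos hg h0
  have h1 : ∀ s ∈ D, ∀ t ∈ D, Λ s * Λ t * ∏ p ∈ s ∪ t, g p / (1 + g p)
      = ∑ d ∈ D, (∏ p ∈ d, (g p)⁻¹) *
        ((if d ⊆ s then Λ s * F s else 0) * (if d ⊆ t then Λ t * F t else 0)) := by
    intro s hs t ht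
    rw [prod_union_eq_sum_diag fun p hp => hg p ⟨s, hs, hp⟩,
      mul_sum]
    have : (s ∩ t).powerset = D.filter (fun d => d ⊆ s ∧ d ⊆ t) := by
      ext d
      simp only [mem_powerset, mem_filter, subset_inter_iff]
      exact ⟨fun h => ⟨hD s hs d h.1, h⟩, fun h => h.2⟩
    rw [this, sum_filter]
    refine sum_congr rfl fun d _ => ?_
    by_cases h1 : d ⊆ s <;> by_cases h2 : d ⊆ t <;> simp [h1, h2, F]
    ring
  calc _ = ∑ s ∈ D, ∑ t ∈ D, ∑ d ∈ D, (∏ p ∈ d, (g p)⁻¹) *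
        ((if d ⊆ s then Λ s * F s else 0) * (if d ⊆ t then Λ t * F t else 0)) :=
        sum_congr rfl fun s hs => sum_congr rfl fun t ht => h1 s hs t ht
    _ = ∑ d ∈ D, (∏ p ∈ d, (g p)⁻¹) *
        ((∑ s ∈ D, if d ⊆ s then Λ s * F s else 0) *
          ∑ t ∈ D, if d ⊆ t then Λ t * F t else 0) := by
        simp_rw [sum_mul_sum, mul_sum]
        rw [sum_comm]
        conv_lhs => enter [2, t]; rw [sum_comm]
        rw [sum_comm]
        exact sum_congr rfl fun d _ => sum_comm
    _ = ∑ d ∈ D, (∏ p ∈ d, g p) / J ^ 2 := by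
        refine sum_congr rfl fun d hd => ?_
        rw [← sum_filter, sum_selbergWeight_diag hg hD hd, ← hJdef]
        have hpos : 0 < ∏ p ∈ d, g p := prod_pos fun p hp => hg p ⟨d, hd, hp⟩
        rw [prod_inv_distrib]
        have : ((-1 : ℝ) ^ #d) ^ 2 = 1 := by rw [← pow_mul, mul_comm, pow_mul]; simp
        field_simp
        exact this
    _ = 1 / J := by
        rw [← sum_div, ← hJdef]
        field_simp

/-- **Selberg's upper bound sieve.** The elements of `A` for which no `p` is bad are counted, when
the number of elements for which all `p ∈ s` are bad is `Y ∏ g / (1 + g)` up to `ν ^ #s`. -/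
theorem selberg_sieve {α : Type*} (A : Finset α) (bad : α → Finset ι) (Y ν : ℝ) (hν : 1 ≤ ν)
    (hg : ∀ p, (∃ s ∈ D, p ∈ s) → 0 < g p) (h0 : ∅ ∈ D) (hD : ∀ s ∈ D, ∀ t ⊆ s, t ∈ D)
    (hcount : ∀ s ∈ D, ∀ t ∈ D,
      |(#{m ∈ A | s ∪ t ⊆ bad m} : ℝ) - Y * ∏ p ∈ s ∪ t, g p / (1 + g p)| ≤ ν ^ #(s ∪ t)) :
    (#{m ∈ A | ∀ s ∈ D, ∀ p ∈ s, p ∉ bad m} : ℝ) ≤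
      Y / (∑ u ∈ D, ∏ p ∈ u, g p) + (∑ s ∈ D, ∏ p ∈ s, (ν * (1 + g p))) ^ 2 := by
  set Λ := selbergWeight g D with hΛ
  have h1 : (#{m ∈ A | ∀ s ∈ D, ∀ p ∈ s, p ∉ bad m} : ℝ)
      ≤ ∑ m ∈ A, (∑ s ∈ D, if s ⊆ bad m then Λ s else 0) ^ 2 := by
    rw [card_filter, Nat.cast_sum]
    refine sum_le_sum fun m _ => ?_
    split_ifs with h
    · have : ∀ s ∈ D, (if s ⊆ bad m then Λ s else 0) = if s = ∅ then Λ ∅ else 0 := by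
        intro s hs
        rcases s.eq_empty_or_nonempty with rfl | ⟨p, hp⟩
        · simp
        · rw [if_neg (fun h' => h s hs p hp (h' hp)), if_neg (ne_empty_of_mem hp)]
      rw [sum_congr rfl this, sum_ite_eq', if_pos h0, hΛ, selbergWeight_empty hg h0]
      simp
    · simpa using sq_nonneg _
  have h2 : ∑ m ∈ A, (∑ s ∈ D, if s ⊆ bad m then Λ s else 0) ^ 2
      = ∑ s ∈ D, ∑ t ∈ D, Λ s * Λ t * #{m ∈ A | s ∪ t ⊆ bad m} := by
    simp_rw [sq, sum_mul_sum]
    rw [sum_comm]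
    refine sum_congr rfl fun s _ => ?_
    rw [sum_comm]
    refine sum_congr rfl fun t _ => ?_
    rw [card_filter, Nat.cast_sum, mul_sum]
    refine sum_congr rfl fun m _ => ?_
    by_cases h1 : s ⊆ bad m <;> by_cases h2 : t ⊆ bad m <;> simp [h1, h2, union_subset_iff]
  have h3 : ∀ s ∈ D, ∀ t ∈ D, Λ s * Λ t * #{m ∈ A | s ∪ t ⊆ bad m} ≤
      Y * (Λ s * Λ t * ∏ p ∈ s ∪ t, g p / (1 + g p))
        + (∏ p ∈ s, (ν * (1 + g p))) * ∏ p ∈ t, (ν * (1 + g p)) := by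
    intro s hs t ht
    have hb := hcount s hs t ht
    have hs' := abs_selbergWeight_le hg h0 hD hs
    have ht' := abs_selbergWeight_le hg h0 hD ht
    have hνst : ν ^ #(s ∪ t) ≤ ν ^ #s * ν ^ #t := by
      rw [← pow_add]
      exact pow_le_pow_right₀ hν (card_union_le s t)
    have h4 : Λ s * Λ t * ((#{m ∈ A | s ∪ t ⊆ bad m} : ℝ) - Y * ∏ p ∈ s ∪ t, g p / (1 + g p))
        ≤ (∏ p ∈ s, (ν * (1 + g p))) * ∏ p ∈ t, (ν * (1 + g p)) := by
      refine (le_abs_self _).trans ?_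
      rw [abs_mul, abs_mul, prod_mul_distrib, prod_mul_distrib, prod_const, prod_const]
      have hns : 0 ≤ ∏ p ∈ s, (1 + g p) := (abs_nonneg _).trans hs'
      have hν0 : 0 ≤ ν := by linarith
      calc _ ≤ (∏ p ∈ s, (1 + g p)) * (∏ p ∈ t, (1 + g p)) * (ν ^ #s * ν ^ #t) :=
            mul_le_mul (mul_le_mul hs' ht' (abs_nonneg _) hns) (hb.trans hνst) (abs_nonneg _)
              (mul_nonneg hns ((abs_nonneg _).trans ht'))
        _ = _ := by ring
    linarith
  calc _ ≤ _ := h1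
    _ = _ := h2
    _ ≤ ∑ s ∈ D, ∑ t ∈ D, (Y * (Λ s * Λ t * ∏ p ∈ s ∪ t, g p / (1 + g p))
        + (∏ p ∈ s, (ν * (1 + g p))) * ∏ p ∈ t, (ν * (1 + g p))) :=
        sum_le_sum fun s hs => sum_le_sum fun t ht => h3 s hs t ht
    _ = _ := by
        simp_rw [sum_add_distrib, ← mul_sum]
        rw [sum_sum_selbergWeight hg h0 hD, ← sum_mul, sq, mul_one_div]

end Selberg

/-! ### Integers in prescribed residue classes -/

theorem abs_card_Ioc_modEq_sub_le (N Q a : ℕ) (hQ : 0 < Q) :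
    |(#{m ∈ Ioc 0 N | m ≡ a [MOD Q]} : ℝ) - N / Q| ≤ 1 := by
  have h := Nat.Ioc_filter_modEq_card 0 N hQ a
  have h' : (#{m ∈ Ioc 0 N | m ≡ a [MOD Q]} : ℤ)
      = ⌊((N : ℚ) - a) / Q⌋ - ⌊((0 : ℕ) - (a : ℚ)) / Q⌋ := by
    rw [h, max_eq_left]
    have : ⌊((0 : ℕ) - (a : ℚ)) / Q⌋ ≤ ⌊((N : ℚ) - a) / Q⌋ := by
      apply Int.floor_le_floor
      gcongr
      simp
    linarith
  have h'' : (#{m ∈ Ioc 0 N | m ≡ a [MOD Q]} : ℚ)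
      = ⌊((N : ℚ) - a) / Q⌋ - ⌊((0 : ℕ) - (a : ℚ)) / Q⌋ := by exact_mod_cast h'
  have key : |(#{m ∈ Ioc 0 N | m ≡ a [MOD Q]} : ℚ) - N / Q| ≤ 1 := by
    have e : (N : ℚ) / Q = ((N : ℚ) - a) / Q - ((0 : ℕ) - (a : ℚ)) / Q := by
      push_cast; ring
    have h1 := Int.floor_le (((N : ℚ) - a) / Q)
    have h2 := Int.lt_floor_add_one (((N : ℚ) - a) / Q)
    have h3 := Int.floor_le (((0 : ℕ) - (a : ℚ)) / Q)
    have h4 := Int.lt_floor_add_one (((0 : ℕ) - (a : ℚ)) / Q)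
    rw [h'', e, abs_le]
    constructor <;> linarith
  have h3 : ((|(#{m ∈ Ioc 0 N | m ≡ a [MOD Q]} : ℚ) - N / Q| : ℚ) : ℝ) ≤ ((1 : ℚ) : ℝ) :=
    Rat.cast_le.2 key
  push_cast at h3
  exact h3

/-- Chinese remainder theorem as an estimate: the integers in `[1, N]` lying in a class modulo `Q`
and in prescribed sets of classes modulo the primes `p ∈ s`. -/
theorem abs_card_residues_sub_le (N : ℕ) (R : ℕ → Finset ℕ) (s : Finset ℕ)
    (hs : ∀ p ∈ s, p.Prime) (hR : ∀ p ∈ s, ∀ ρ ∈ R p, ρ < p) :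
    ∀ (Q a : ℕ), 0 < Q → (∀ p ∈ s, Q.Coprime p) →
    |(#{m ∈ Ioc 0 N | m ≡ a [MOD Q] ∧ ∀ p ∈ s, m % p ∈ R p} : ℝ)
      - N / Q * ∏ p ∈ s, ((#(R p) : ℝ) / p)| ≤ ∏ p ∈ s, (#(R p) : ℝ) := by
  induction s using Finset.induction_on with
  | empty =>
    intro Q a hQ _
    simpa using abs_card_Ioc_modEq_sub_le N Q a hQ
  | insert p s hps ih =>
    intro Q a hQ hcop
    have hp : p.Prime := hs p (mem_insert_self p s)
    have hQp : Q.Coprime p := hcop p (mem_insert_self p s)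
    have ih' := ih (fun q hq => hs q (mem_insert_of_mem hq)) fun q hq => hR q (mem_insert_of_mem hq)
    have hsplit : #{m ∈ Ioc 0 N | m ≡ a [MOD Q] ∧ ∀ q ∈ insert p s, m % q ∈ R q}
        = ∑ ρ ∈ R p, #{m ∈ Ioc 0 N | m ≡ (Nat.chineseRemainder hQp a ρ : ℕ) [MOD Q * p]
            ∧ ∀ q ∈ s, m % q ∈ R q} := by
      rw [← card_biUnion]
      · congr 1
        ext m
        simp only [mem_filter, mem_biUnion, forall_mem_insert]
        constructor
        · rintro ⟨hm, hma, hmp, hms⟩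
          refine ⟨m % p, hmp, hm, ?_, hms⟩
          exact Nat.chineseRemainder_modEq_unique hQp hma (Nat.mod_modEq m p).symm
        · rintro ⟨ρ, hρ, hm, hmod, hms⟩
          have h2 := (Nat.chineseRemainder hQp a ρ).2
          have h3 : m ≡ ρ [MOD p] := (hmod.of_mul_left Q).trans h2.2
          refine ⟨hm, (hmod.of_mul_right p).trans h2.1, ?_, hms⟩
          have : m % p = ρ := by
            rw [h3, Nat.mod_eq_of_lt (hR p (mem_insert_self p s) ρ hρ)]
          rwa [this]
      · intro ρ hρ ρ' hρ' hne
        rw [Function.onFun, disjoint_left]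
        intro m hm hm'
        apply hne
        have h1 : m ≡ ρ [MOD p] :=
          ((mem_filter.1 hm).2.1.of_mul_left Q).trans (Nat.chineseRemainder hQp a ρ).2.2
        have h2 : m ≡ ρ' [MOD p] :=
          ((mem_filter.1 hm').2.1.of_mul_left Q).trans (Nat.chineseRemainder hQp a ρ').2.2
        have h3 := h1.symm.trans h2
        rwa [Nat.ModEq, Nat.mod_eq_of_lt (hR p (mem_insert_self p s) ρ hρ),
          Nat.mod_eq_of_lt (hR p (mem_insert_self p s) ρ' hρ')] at h3
    have hmain : (N : ℝ) / Q * ∏ q ∈ insert p s, ((#(R q) : ℝ) / q)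
        = ∑ _ρ ∈ R p, (N : ℝ) / (Q * p : ℕ) * ∏ q ∈ s, ((#(R q) : ℝ) / q) := by
      rw [prod_insert hps, sum_const, nsmul_eq_mul]
      push_cast
      have h1 : (p : ℝ) ≠ 0 := by exact_mod_cast hp.ne_zero
      have h2 : (Q : ℝ) ≠ 0 := by exact_mod_cast hQ.ne'
      field_simp
    rw [hsplit, hmain, prod_insert hps, Nat.cast_sum, ← sum_sub_distrib]
    refine (abs_sum_le_sum_abs _ _).trans ?_
    rw [← nsmul_eq_mul, ← sum_const]
    refine sum_le_sum fun ρ _ => ih' (Q * p) _ (Nat.mul_pos hQ hp.pos) fun q hq => ?_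
    refine Nat.Coprime.mul_left (hcop q (mem_insert_of_mem hq)) ?_
    refine (Nat.coprime_primes hp (hs q (mem_insert_of_mem hq))).2 ?_
    rintro rfl
    exact hps hq

/-- If `E` is distinct modulo `p`, exactly `#E` classes modulo `p` make some `m + x`, `x ∈ E`,
divisible by `p`. -/
theorem card_residues_dvd_add {p : ℕ} (hp : 0 < p) (E : Finset ℕ)
    (hE : ∀ x ∈ E, ∀ y ∈ E, x ≡ y [MOD p] → x = y) :
    #{ρ ∈ range p | ∃ x ∈ E, p ∣ ρ + x} = #E := by
  symm
  have key : ∀ x : ℕ, p ∣ (p - x % p) % p + x := fun x => by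
    rw [Nat.dvd_iff_mod_eq_zero, Nat.mod_add_mod, ← Nat.add_mod_mod,
      Nat.sub_add_cancel (Nat.mod_lt x hp).le, Nat.mod_self]
  refine card_nbij (fun x => (p - x % p) % p) ?_ ?_ ?_
  · intro x hx
    simp only [coe_filter, mem_range, Set.mem_ofPred_eq]
    exact ⟨Nat.mod_lt _ hp, x, hx, key x⟩
  · intro x hx y hy h
    refine hE x hx y hy ?_
    have h1 := key x
    have h2 := key y
    simp only at h
    rw [h] at h1
    exact Nat.ModEq.add_left_cancel' ((p - y % p) % p)
      (((Nat.modEq_zero_iff_dvd).2 h1).trans ((Nat.modEq_zero_iff_dvd).2 h2).symm)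
  · intro ρ hρ
    simp only [coe_filter, mem_range, Set.mem_ofPred_eq] at hρ
    obtain ⟨hρ, x, hx, hd⟩ := hρ
    refine ⟨x, hx, ?_⟩
    have h3 : (p - x % p) % p + x ≡ ρ + x [MOD p] :=
      ((Nat.modEq_zero_iff_dvd).2 (key x)).trans ((Nat.modEq_zero_iff_dvd).2 hd).symm
    have h4 := Nat.ModEq.add_right_cancel' x h3
    rw [Nat.ModEq, Nat.mod_mod, Nat.mod_eq_of_lt hρ] at h4
    exact h4

/-! ### Selberg's sum and its recursion in the sieve dimension -/

/-- The squarefree integers `≤ y` composed of primes in `Pr`, each encoded as the set of its prime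
factors. -/
noncomputable def sieveFamily (Pr : Finset ℕ) (y : ℝ) : Finset (Finset ℕ) :=
  {s ∈ Pr.powerset | ∏ p ∈ s, (p : ℝ) ≤ y}

/-- Selberg's sum `J` in sieve dimension `κ`: the sum of `∏_{p ∣ l} κ / (p - κ)` over the
squarefree `l ≤ y` composed of primes in `Pr`. -/
noncomputable def selbergSum (κ : ℕ) (Pr : Finset ℕ) (y : ℝ) : ℝ :=
  ∑ s ∈ sieveFamily Pr y, ∏ p ∈ s, (κ : ℝ) / (p - κ)

theorem mem_sieveFamily {Pr s : Finset ℕ} {y : ℝ} :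
    s ∈ sieveFamily Pr y ↔ s ⊆ Pr ∧ ∏ p ∈ s, (p : ℝ) ≤ y := by
  simp [sieveFamily]

theorem sum_Icc_inv_pow_le {p : ℕ} (hp : 2 ≤ p) (K : ℕ) :
    ∑ e ∈ Icc 1 K, ((p : ℝ) ^ e)⁻¹ ≤ 1 / ((p : ℝ) - 1) := by
  have hp' : (2 : ℝ) ≤ p := by exact_mod_cast hp
  have h1 : (0 : ℝ) < p - 1 := by linarith
  have key : ∑ e ∈ Icc 1 K, ((p : ℝ) ^ e)⁻¹ = (1 - ((p : ℝ) ^ K)⁻¹) / (p - 1) := by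
    induction K with
    | zero => simp
    | succ K ih =>
      rw [sum_Icc_succ_top (by omega), ih]
      have : (p : ℝ) ≠ 0 := by linarith
      field_simp
      ring
  rw [key]
  gcongr
  have : 0 ≤ ((p : ℝ) ^ K)⁻¹ := by positivity
  linarith

/-- The reciprocals of the integers with a given set of prime factors. -/
theorem sum_inv_primeFactors_eq_le (u : Finset ℕ) (hu : ∀ p ∈ u, p.Prime) :
    ∀ M : Finset ℕ, 0 ∉ M →
    ∑ m ∈ M with m.primeFactors = u, (1 : ℝ) / m ≤ ∏ p ∈ u, 1 / ((p : ℝ) - 1) := by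
  induction u using Finset.induction_on with
  | empty =>
    intro M hM
    rw [prod_empty]
    calc ∑ m ∈ M with m.primeFactors = ∅, (1 : ℝ) / m ≤ ∑ m ∈ ({1} : Finset ℕ), (1 : ℝ) / m := by
          refine sum_le_sum_of_subset_of_nonneg ?_ fun m _ _ => by positivity
          intro m hm
          rw [mem_filter, Nat.primeFactors_eq_empty] at hm
          rcases hm with ⟨hm, rfl | rfl⟩
          · exact absurd hm hM
          · simp
      _ = 1 := by simp
  | insert p u hpu ih =>
    intro M hM
    have hp : p.Prime := hu p (mem_insert_self p u)
    have hu' : ∀ q ∈ u, q.Prime := fun q hq => hu q (mem_insert_of_mem hq)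
    set M' := M.image fun m => m / p ^ m.factorization p with hM'
    set K := M.sup fun m => m.factorization p with hK
    have h0 : 0 ∉ M' := by
      intro h
      obtain ⟨m, hm, h⟩ := mem_image.1 h
      have hm0 : m ≠ 0 := fun h' => hM (h' ▸ hm)
      exact (Nat.ordCompl_pos p hm0).ne' h
    rw [prod_insert hpu]
    calc ∑ m ∈ M with m.primeFactors = insert p u, (1 : ℝ) / m
        = ∑ m ∈ M with m.primeFactors = insert p u,
            ((p : ℝ) ^ (m.factorization p))⁻¹ * (1 / ((m / p ^ m.factorization p : ℕ) : ℝ)) := by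
          refine sum_congr rfl fun m hm => ?_
          have h1 : (m : ℝ) = (p : ℝ) ^ m.factorization p * (m / p ^ m.factorization p : ℕ) := by
            exact_mod_cast (Nat.ordProj_mul_ordCompl_eq_self m p).symm
          conv_lhs => rw [h1]
          rw [one_div, mul_inv, one_div]
      _ = ∑ x ∈ (M.filter (·.primeFactors = insert p u)).image
            (fun m => (m.factorization p, m / p ^ m.factorization p)),
            ((p : ℝ) ^ x.1)⁻¹ * (1 / (x.2 : ℝ)) := by
          rw [sum_image]
          intro m hm m' hm' h
          simp only [Prod.mk.injEq] at h
          rw [← Nat.ordProj_mul_ordCompl_eq_self m p, ← Nat.ordProj_mul_ordCompl_eq_self m' p,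
            h.2, h.1]
      _ ≤ ∑ x ∈ (Icc 1 K) ×ˢ (M'.filter (·.primeFactors = u)),
            ((p : ℝ) ^ x.1)⁻¹ * (1 / (x.2 : ℝ)) := by
          refine sum_le_sum_of_subset_of_nonneg ?_ fun x _ _ => by positivity
          intro x hx
          obtain ⟨m, hm, rfl⟩ := mem_image.1 hx
          obtain ⟨hmM, hmu⟩ := mem_filter.1 hm
          have hpm : p ∈ m.primeFactors := hmu ▸ mem_insert_self p u
          rw [mem_product, mem_Icc, mem_filter]
          refine ⟨⟨?_, ?_⟩, mem_image_of_mem _ hmM, ?_⟩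
          · exact Nat.one_le_iff_ne_zero.2 (Finsupp.mem_support_iff.1 hpm)
          · exact le_sup (f := fun m : ℕ => m.factorization p) hmM
          · change (m / p ^ m.factorization p).primeFactors = u
            rw [← Nat.support_factorization, Nat.factorization_ordCompl, Finsupp.support_erase,
              Nat.support_factorization, hmu, erase_insert hpu]
      _ = (∑ e ∈ Icc 1 K, ((p : ℝ) ^ e)⁻¹) * ∑ m ∈ M' with m.primeFactors = u, (1 : ℝ) / m := by
          rw [sum_product, sum_mul_sum]
      _ ≤ _ := by
          have h1 : (2 : ℝ) ≤ p := by exact_mod_cast hp.two_le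
          refine mul_le_mul (sum_Icc_inv_pow_le hp.two_le K) (ih hu' M' h0)
            (sum_nonneg fun m _ => by positivity) (by apply one_div_nonneg.2; linarith)

/-- Dirichlet convolution of functions on squarefree integers, with least common multiple in place
of product, is multiplicative. -/
theorem sum_union_eq_prod (a b : ℕ → ℝ) (s : Finset ℕ) :
    ∑ t ∈ s.powerset, ∑ u ∈ s.powerset with t ∪ u = s, (∏ p ∈ t, a p) * ∏ p ∈ u, b p
      = ∏ p ∈ s, (a p * (1 + b p) + b p) := by
  rw [prod_add]
  refine sum_congr rfl fun t ht => ?_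
  have hts := mem_powerset.1 ht
  rw [prod_mul_distrib, ← mul_sum, mul_assoc]
  congr 1
  rw [prod_one_add, sum_mul]
  symm
  refine sum_nbij' (fun v => (s \ t) ∪ v) (fun u => u ∩ t) ?_ ?_ ?_ ?_ ?_
  · intro v hv
    have hvt := mem_powerset.1 hv
    rw [mem_filter, mem_powerset]
    refine ⟨union_subset sdiff_subset (hvt.trans hts), ?_⟩
    rw [← union_assoc, union_sdiff_of_subset hts, union_eq_left.2 (hvt.trans hts)]
  · intro u _
    exact mem_powerset.2 inter_subset_right
  · intro v hv
    have hvt := mem_powerset.1 hv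
    rw [union_inter_distrib_right, sdiff_inter_self, empty_union, inter_eq_left.2 hvt]
  · intro u hu
    obtain ⟨hus, htu⟩ := mem_filter.1 hu
    have hus := mem_powerset.1 hus
    ext p
    have h1 := @hus p
    have h2 : p ∈ s ↔ p ∈ t ∨ p ∈ u := by rw [← htu, mem_union]
    simp only [mem_union, mem_sdiff, mem_inter]
    tauto
  · intro v hv
    have hvt := mem_powerset.1 hv
    rw [prod_union (disjoint_of_subset_right hvt sdiff_disjoint), mul_comm]

theorem selbergSum_nonneg {κ : ℕ} {Pr : Finset ℕ} (h : ∀ p ∈ Pr, κ < p) (y : ℝ) :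
    0 ≤ selbergSum κ Pr y := by
  refine sum_nonneg fun s hs => prod_nonneg fun p hp => ?_
  have : (κ : ℝ) < p := by exact_mod_cast h p ((mem_sieveFamily.1 hs).1 hp)
  exact div_nonneg (Nat.cast_nonneg _) (by linarith)

theorem selbergSum_mono {κ : ℕ} {Pr : Finset ℕ} (h : ∀ p ∈ Pr, κ < p) {y y' : ℝ} (hy : y ≤ y') :
    selbergSum κ Pr y ≤ selbergSum κ Pr y' := by
  refine sum_le_sum_of_subset_of_nonneg ?_ fun s hs _ => prod_nonneg fun p hp => ?_
  · intro s hs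
    rw [mem_sieveFamily] at hs ⊢
    exact ⟨hs.1, hs.2.trans hy⟩
  have : (κ : ℝ) < p := by exact_mod_cast h p ((mem_sieveFamily.1 hs).1 hp)
  exact div_nonneg (Nat.cast_nonneg _) (by linarith)

/-- Raising the sieve dimension by one dominates a convolution with `1 / m`. -/
theorem sum_inv_mul_selbergSum_le {κ : ℕ} {Pr : Finset ℕ} (hprime : ∀ p ∈ Pr, p.Prime)
    (h : ∀ p ∈ Pr, κ + 1 < p) (M : Finset ℕ) (h0 : 0 ∉ M) (hM : ∀ m ∈ M, m.primeFactors ⊆ Pr)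
    (y : ℝ) :
    ∑ m ∈ M, 1 / (m : ℝ) * selbergSum κ Pr (y / m) ≤ selbergSum (κ + 1) Pr y := by
  set a : ℕ → ℝ := fun p => (κ : ℝ) / (p - κ)
  set b : ℕ → ℝ := fun p => 1 / ((p : ℝ) - 1)
  have ha : ∀ s ⊆ Pr, 0 ≤ ∏ p ∈ s, a p := fun s hs => prod_nonneg fun p hp => by
    have : (κ : ℝ) + 1 < p := by exact_mod_cast h p (hs hp)
    exact div_nonneg (Nat.cast_nonneg _) (by linarith)
  have h1 : ∀ m ∈ M, 1 / (m : ℝ) * selbergSum κ Pr (y / m)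
      ≤ ∑ t ∈ Pr.powerset, if ∏ p ∈ t ∪ m.primeFactors, (p : ℝ) ≤ y then
          (∏ p ∈ t, a p) * (1 / (m : ℝ)) else 0 := by
    intro m hm
    have hm0 : m ≠ 0 := fun h' => h0 (h' ▸ hm)
    have hmpos : (0 : ℝ) < m := by exact_mod_cast Nat.pos_of_ne_zero hm0
    rw [selbergSum, mul_comm, sum_mul, ← sum_filter]
    refine sum_le_sum_of_subset_of_nonneg ?_ fun t ht _ =>
      mul_nonneg (ha t (mem_powerset.1 (mem_filter.1 ht).1)) (by positivity)
    intro t ht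
    rw [mem_sieveFamily, le_div_iff₀ hmpos] at ht
    refine mem_filter.2 ⟨mem_powerset.2 ht.1, le_trans ?_ ht.2⟩
    have h2 : ∏ p ∈ t ∪ m.primeFactors, (p : ℝ)
        ≤ (∏ p ∈ t, (p : ℝ)) * ∏ p ∈ m.primeFactors, (p : ℝ) := by
      rw [← prod_union_inter]
      refine le_mul_of_one_le_right (prod_nonneg fun p _ => Nat.cast_nonneg p) ?_
      refine one_le_prod fun p hp => ?_
      exact_mod_cast (Nat.prime_of_mem_primeFactors (mem_inter.1 hp).2).one_le
    refine h2.trans (mul_le_mul_of_nonneg_left ?_ (prod_nonneg fun p _ => Nat.cast_nonneg p))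
    rw [← Nat.cast_prod]
    exact_mod_cast Nat.le_of_dvd (Nat.pos_of_ne_zero hm0) (Nat.prod_primeFactors_dvd m)
  calc _ ≤ ∑ m ∈ M, ∑ t ∈ Pr.powerset, (if ∏ p ∈ t ∪ m.primeFactors, (p : ℝ) ≤ y then
          (∏ p ∈ t, a p) * (1 / (m : ℝ)) else 0) := sum_le_sum h1
    _ = ∑ t ∈ Pr.powerset, ∑ u ∈ Pr.powerset, ∑ m ∈ M with m.primeFactors = u,
          if ∏ p ∈ t ∪ u, (p : ℝ) ≤ y then (∏ p ∈ t, a p) * (1 / (m : ℝ)) else 0 := by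
        rw [sum_comm]
        refine sum_congr rfl fun t _ => ?_
        rw [← sum_fiberwise_of_maps_to (g := Nat.primeFactors) (t := Pr.powerset)
          fun m hm => mem_powerset.2 (hM m hm)]
        refine sum_congr rfl fun u _ => sum_congr rfl fun m hm => ?_
        rw [(mem_filter.1 hm).2]
    _ ≤ ∑ t ∈ Pr.powerset, ∑ u ∈ Pr.powerset,
          if ∏ p ∈ t ∪ u, (p : ℝ) ≤ y then (∏ p ∈ t, a p) * ∏ p ∈ u, b p else 0 := by
        refine sum_le_sum fun t ht => sum_le_sum fun u hu => ?_
        split_ifs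
        · rw [← mul_sum]
          exact mul_le_mul_of_nonneg_left (sum_inv_primeFactors_eq_le u
            (fun p hp => hprime p (mem_powerset.1 hu hp)) M h0) (ha t (mem_powerset.1 ht))
        · simp
    _ = ∑ s ∈ sieveFamily Pr y, ∑ t ∈ s.powerset, ∑ u ∈ s.powerset with t ∪ u = s,
          (∏ p ∈ t, a p) * ∏ p ∈ u, b p := by
        have h2 : ∀ s ∈ sieveFamily Pr y, ∑ t ∈ s.powerset, ∑ u ∈ s.powerset with t ∪ u = s,
            (∏ p ∈ t, a p) * ∏ p ∈ u, b p
            = ∑ t ∈ Pr.powerset, ∑ u ∈ Pr.powerset,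
              if s = t ∪ u then (∏ p ∈ t, a p) * ∏ p ∈ u, b p else 0 := by
          intro s hs
          have hsPr := (mem_sieveFamily.1 hs).1
          have h3 : ∀ t, ∑ u ∈ s.powerset with t ∪ u = s, (∏ p ∈ t, a p) * ∏ p ∈ u, b p
              = ∑ u ∈ Pr.powerset, if s = t ∪ u then (∏ p ∈ t, a p) * ∏ p ∈ u, b p else 0 := by
            intro t
            rw [← sum_filter]
            congr 1
            ext u
            simp only [mem_filter, mem_powerset]
            constructor
            · rintro ⟨hu, rfl⟩
              exact ⟨hu.trans hsPr, rfl⟩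
            · rintro ⟨_, rfl⟩
              exact ⟨subset_union_right, rfl⟩
          rw [sum_congr rfl fun t _ => h3 t]
          refine sum_subset (powerset_mono.2 hsPr) fun t _ hts => ?_
          refine sum_eq_zero fun u _ => if_neg ?_
          rintro rfl
          exact hts (mem_powerset.2 subset_union_left)
        rw [sum_congr rfl h2]
        symm
        rw [sum_comm]
        refine sum_congr rfl fun t ht => ?_
        rw [sum_comm]
        refine sum_congr rfl fun u hu => ?_
        rw [sum_ite_eq']
        refine if_congr ?_ rfl rfl
        rw [mem_sieveFamily]
        exact ⟨fun h => h.2, fun h => ⟨union_subset (mem_powerset.1 ht) (mem_powerset.1 hu), h⟩⟩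
    _ ≤ selbergSum (κ + 1) Pr y := by
        refine sum_le_sum fun s hs => ?_
        rw [sum_union_eq_prod]
        have hk : ∀ p ∈ s, (κ : ℝ) + 1 < p := fun p hp => by
          exact_mod_cast h p ((mem_sieveFamily.1 hs).1 hp)
        have hκ : (0 : ℝ) ≤ κ := Nat.cast_nonneg κ
        refine prod_le_prod (fun p hp => ?_) fun p hp => ?_
        · have := hk p hp
          have h3 : 0 ≤ a p := div_nonneg hκ (by linarith)
          have h4 : 0 ≤ b p := one_div_nonneg.2 (by linarith)
          positivity
        · have := hk p hp
          have h3 : (0 : ℝ) < p - κ := by linarith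
          have h4 : (0 : ℝ) < p - 1 := by linarith
          have h5 : (0 : ℝ) < p - (κ + 1) := by linarith
          have e : a p * (1 + b p) + b p = (κ * p + p - κ) / ((p - κ) * (p - 1)) := by
            simp only [a, b]
            field_simp
            ring
          rw [e, div_le_div_iff₀ (mul_pos h3 h4) (by push_cast; linarith)]
          push_cast
          nlinarith [mul_nonneg hκ (by linarith : (0 : ℝ) ≤ p)]

/-! ### Lower bound for Selberg's sum -/

theorem log_div_le_sum_Ico_inv (q₀ q₁ : ℕ) :
    Real.log ((q₁ + 1) / (q₀ + 1)) ≤ ∑ q ∈ Ico q₀ q₁, 1 / ((q : ℝ) + 1) := by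
  rcases le_total q₀ q₁ with h | h
  · induction q₁, h using Nat.le_induction with
    | base =>
      rw [div_self (by positivity)]
      simp
    | succ q hq ih =>
      rw [sum_Ico_succ_top hq]
      have h0 : (0 : ℝ) < q₀ + 1 := by positivity
      have h1 : (0 : ℝ) < q + 1 := by positivity
      have h2 : ((q + 1 : ℕ) + 1 : ℝ) / (q₀ + 1) = (q + 1) / (q₀ + 1) * ((q + 2) / (q + 1)) := by
        push_cast
        field_simp
        ring
      rw [h2, Real.log_mul (by positivity) (by positivity)]
      have h3 := Real.log_le_sub_one_of_pos (show (0 : ℝ) < (q + 2) / (q + 1) by positivity)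
      have h4 : ((q : ℝ) + 2) / (q + 1) - 1 = 1 / (q + 1) := by field_simp; ring
      linarith
  · rw [Ico_eq_empty_of_le h, sum_empty]
    refine Real.log_nonpos (by positivity) ?_
    rw [div_le_one (by positivity)]
    gcongr

theorem totient_div_mul_sum_le_sum_coprime (P : ℕ) (hP : 0 < P) {q₀ q₁ : ℕ} (h0 : 0 < q₀)
    (h : q₀ ≤ q₁) :
    (P.totient : ℝ) / P * ∑ q ∈ Ico q₀ q₁, 1 / ((q : ℝ) + 1)
      ≤ ∑ m ∈ Ico (q₀ * P) (q₁ * P) with P.Coprime m, 1 / (m : ℝ) := by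
  induction q₁, h using Nat.le_induction with
  | base => simp
  | succ q hq ih =>
    rw [sum_Ico_succ_top hq, mul_add, sum_filter,
      ← sum_Ico_consecutive _ (Nat.mul_le_mul_right P hq) (Nat.mul_le_mul_right P q.le_succ),
      ← sum_filter, ← sum_filter]
    refine add_le_add ih ?_
    rw [Nat.succ_mul, ← Nat.filter_coprime_Ico_eq_totient P (q * P)]
    have hP' : (0 : ℝ) < P := by exact_mod_cast hP
    have h1 : ∀ m ∈ (Ico (q * P) (q * P + P)).filter P.Coprime,
        1 / (((q : ℝ) + 1) * P) ≤ 1 / (m : ℝ) := by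
      intro m hm
      obtain ⟨hm1, hm2⟩ := mem_filter.1 hm
      rw [mem_Ico] at hm1
      have hm0 : 0 < m := (Nat.mul_pos (h0.trans_le hq) hP).trans_le hm1.1
      have : (m : ℝ) ≤ (q + 1) * P := by
        have : m ≤ (q + 1) * P := by rw [add_mul, one_mul]; exact hm1.2.le
        exact_mod_cast this
      exact one_div_le_one_div_of_le (by exact_mod_cast hm0) this
    calc _ = ∑ _m ∈ (Ico (q * P) (q * P + P)).filter P.Coprime, 1 / (((q : ℝ) + 1) * P) := by
          rw [sum_const, nsmul_eq_mul]
          field_simp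
      _ ≤ _ := sum_le_sum h1

/-- Each full period `[q P, (q + 1) P)` inside `(x, y]` contributes at least `(φ(P) / P) / (q + 1)`. -/
theorem sum_coprime_inv_ge (P : ℕ) (hP : 0 < P) {x y : ℝ} (hx : 1 ≤ x) (hy : 0 < y) :
    (P.totient : ℝ) / P * (Real.log (y / x) - Real.log (1 + 2 * P))
      ≤ ∑ m ∈ Ioc ⌊x⌋₊ ⌊y⌋₊ with P.Coprime m, 1 / (m : ℝ) := by
  have hP' : (0 : ℝ) < P := by exact_mod_cast hP
  have hx0 : 0 < x := by linarith
  set q₀ := ⌊x / P⌋₊ + 1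
  set q₁ := ⌊y / P⌋₊
  have hq₀ : ((q₀ : ℝ) + 1) ≤ x * (1 + 2 * P) / P := by
    have h1 : (⌊x / P⌋₊ : ℝ) ≤ x / P := Nat.floor_le (by positivity)
    rw [le_div_iff₀ hP']
    have h2 : (⌊x / P⌋₊ : ℝ) * P ≤ x := (le_div_iff₀ hP').1 h1
    simp only [q₀]
    push_cast
    nlinarith
  have hq₁ : y / P ≤ (q₁ : ℝ) + 1 := (Nat.lt_floor_add_one _).le
  have hlog : Real.log (y / x) - Real.log (1 + 2 * P) ≤ Real.log ((q₁ + 1) / (q₀ + 1)) := by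
    rw [← Real.log_div (by positivity) (by positivity)]
    refine Real.log_le_log (by positivity) ?_
    have e : y / x / (1 + 2 * P) = (y / P) / (x * (1 + 2 * P) / P) := by field_simp
    rw [e]
    gcongr
  have hφ : 0 ≤ (P.totient : ℝ) / P := by positivity
  refine (mul_le_mul_of_nonneg_left (hlog.trans (log_div_le_sum_Ico_inv q₀ q₁)) hφ).trans ?_
  rcases le_total q₀ q₁ with h | h
  · refine (totient_div_mul_sum_le_sum_coprime P hP (Nat.succ_pos _) h).trans ?_
    refine sum_le_sum_of_subset_of_nonneg ?_ fun m _ _ => by positivity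
    intro m hm
    rw [mem_filter, mem_Ico] at hm
    rw [mem_filter, mem_Ioc]
    refine ⟨⟨?_, ?_⟩, hm.2⟩
    · rw [Nat.floor_lt hx0.le]
      have h1 : x / P < (q₀ : ℝ) := by
        simp only [q₀]
        push_cast
        exact Nat.lt_floor_add_one _
      rw [div_lt_iff₀ hP'] at h1
      exact h1.trans_le (by exact_mod_cast hm.1.1)
    · refine Nat.le_floor ?_
      have h1 : (q₁ : ℝ) * P ≤ y := (le_div_iff₀ hP').1 (Nat.floor_le (by positivity))
      exact le_trans (by exact_mod_cast hm.1.2.le) h1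
  · rw [Ico_eq_empty_of_le h, sum_empty, mul_zero]
    exact sum_nonneg fun m _ => by positivity

theorem sum_range_choose_left (κ j : ℕ) : ∑ i ∈ range j, i.choose κ = j.choose (κ + 1) := by
  induction j with
  | zero => simp
  | succ j ih => rw [sum_range_succ, ih, Nat.choose_succ_succ, add_comm]

theorem sum_range_sum_Ioc (a : ℕ → ℕ) (ha : Monotone a) (F : ℕ → ℝ) (j : ℕ) :
    ∑ i ∈ range j, ∑ m ∈ Ioc (a i) (a (i + 1)), F m = ∑ m ∈ Ioc (a 0) (a j), F m := by
  induction j with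
  | zero => simp
  | succ j ih =>
    rw [sum_range_succ, ih, sum_Ioc_consecutive _ (ha (Nat.zero_le j)) (ha j.le_succ)]

/-- Lower bound for Selberg's sum in dimension `κ`, by cutting `[1, exp (j L)]` into `j` blocks
`(exp (i L), exp ((i + 1) L)]`, each carrying mass at least `β` of the reciprocals of the integers
coprime to `P`. For `j` large the right-hand side is close to `(j β) ^ κ / κ!`. -/
theorem choose_mul_pow_le_selbergSum (P : ℕ) (hP : 0 < P) (Pr : Finset ℕ)
    (hprime : ∀ p ∈ Pr, p.Prime) {L β : ℝ} (hL : 0 ≤ L) (hβ : 0 ≤ β)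
    (hβL : β ≤ (P.totient : ℝ) / P * (L - Real.log (1 + 2 * P))) (j₀ : ℕ)
    (hPr : ∀ m : ℕ, m ≠ 0 → (m : ℝ) ≤ Real.exp (j₀ * L) → P.Coprime m → m.primeFactors ⊆ Pr)
    (κ : ℕ) :
    (∀ p ∈ Pr, κ < p) → ∀ j ≤ j₀,
      (j.choose κ : ℝ) * β ^ κ ≤ selbergSum κ Pr (Real.exp (j * L)) := by
  induction κ with
  | zero =>
    intro _ j _
    have h1 : ∅ ∈ sieveFamily Pr (Real.exp (j * L)) := by
      rw [mem_sieveFamily, prod_empty]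
      exact ⟨empty_subset _, Real.one_le_exp (by positivity)⟩
    have h2 := single_le_sum (f := fun s : Finset ℕ => ∏ p ∈ s, ((0 : ℕ) : ℝ) / (p - (0 : ℕ)))
      (fun s _ => prod_nonneg fun p _ => by simp) h1
    simpa [selbergSum] using h2
  | succ κ ih =>
    intro hκ j hj
    have hκ' : ∀ p ∈ Pr, κ < p := fun p hp => (Nat.lt_succ_self κ).trans (hκ p hp)
    set a : ℕ → ℕ := fun i => ⌊Real.exp (i * L)⌋₊ with ha_def
    have ha : Monotone a := fun i i' h => by
      refine Nat.floor_le_floor (Real.exp_le_exp.2 ?_)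
      gcongr
    set M := (Ioc (a 0) (a j)).filter P.Coprime with hM
    have hMpos : ∀ m ∈ M, m ≠ 0 := fun m hm =>
      (Nat.zero_le _ |>.trans_lt (mem_Ioc.1 (mem_filter.1 hm).1).1).ne'
    have hstep := sum_inv_mul_selbergSum_le hprime hκ M (fun h => hMpos 0 h rfl)
      (fun m hm => hPr m (hMpos m hm) (by
        have h1 := (mem_Ioc.1 (mem_filter.1 hm).1).2
        have h2 : (m : ℝ) ≤ Real.exp (j * L) :=
          le_trans (by exact_mod_cast h1) (Nat.floor_le (Real.exp_pos _).le)
        refine h2.trans (Real.exp_le_exp.2 ?_)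
        gcongr) (mem_filter.1 hm).2) (Real.exp (j * L))
    refine le_trans ?_ hstep
    rw [hM, sum_filter, ← sum_range_sum_Ioc a ha]
    have hblock : ∀ i ∈ range j, ((j - 1 - i).choose κ : ℝ) * β ^ (κ + 1)
        ≤ ∑ m ∈ Ioc (a i) (a (i + 1)), if P.Coprime m then
          1 / (m : ℝ) * selbergSum κ Pr (Real.exp (j * L) / m) else 0 := by
      intro i hi
      have hij : i + 1 ≤ j := mem_range.1 hi
      have hcast : ((j - 1 - i : ℕ) : ℝ) = j - (i + 1) := by
        rw [Nat.sub_sub, add_comm 1 i, Nat.cast_sub hij]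
        push_cast
        ring
      have h1 := ih hκ' (j - 1 - i) (by omega)
      have h2 : β ≤ ∑ m ∈ Ioc (a i) (a (i + 1)) with P.Coprime m, 1 / (m : ℝ) := by
        refine le_trans ?_ (sum_coprime_inv_ge P hP (Real.one_le_exp (by positivity))
          (Real.exp_pos _))
        rw [← Real.exp_sub, Real.log_exp]
        refine hβL.trans_eq ?_
        push_cast
        ring
      calc ((j - 1 - i).choose κ : ℝ) * β ^ (κ + 1)
          = β * (((j - 1 - i).choose κ : ℝ) * β ^ κ) := by ring
        _ ≤ (∑ m ∈ Ioc (a i) (a (i + 1)) with P.Coprime m, 1 / (m : ℝ))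
            * selbergSum κ Pr (Real.exp ((j - 1 - i : ℕ) * L)) :=
            mul_le_mul h2 h1 (by positivity) (hβ.trans h2)
        _ ≤ _ := by
            rw [sum_mul, ← sum_filter]
            refine sum_le_sum fun m hm => ?_
            obtain ⟨hm, -⟩ := mem_filter.1 hm
            have hm' := mem_Ioc.1 hm
            have hmpos : (0 : ℝ) < m := by exact_mod_cast (Nat.zero_le _).trans_lt hm'.1
            refine mul_le_mul_of_nonneg_left (selbergSum_mono hκ' ?_) (by positivity)
            have h3 : (m : ℝ) ≤ Real.exp ((i + 1 : ℕ) * L) :=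
              le_trans (by exact_mod_cast hm'.2) (Nat.floor_le (Real.exp_pos _).le)
            rw [le_div_iff₀ hmpos]
            refine (mul_le_mul_of_nonneg_left h3 (Real.exp_pos _).le).trans_eq ?_
            rw [← Real.exp_add, hcast]
            congr 1
            push_cast
            ring
    refine le_trans (le_of_eq ?_) (sum_le_sum hblock)
    rw [← sum_mul, sum_range_reflect (fun i => (i.choose κ : ℝ)) j, ← Nat.cast_sum,
      sum_range_choose_left]

/-- Deleting a set `T` of primes from the sieve costs at most the full Euler factor over `T`. -/
theorem selbergSum_le_prod_mul {κ : ℕ} {Pr T : Finset ℕ} (hκ : ∀ p ∈ Pr, κ < p) (hT : T ⊆ Pr)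
    (hprime : ∀ p ∈ Pr, p.Prime) (y : ℝ) :
    selbergSum κ Pr y ≤ (∏ p ∈ T, (1 + (κ : ℝ) / (p - κ))) * selbergSum κ (Pr \ T) y := by
  have hg : ∀ s ⊆ Pr, 0 ≤ ∏ p ∈ s, (κ : ℝ) / (p - κ) := fun s hs => prod_nonneg fun p hp => by
    have : (κ : ℝ) < p := by exact_mod_cast hκ p (hs hp)
    exact div_nonneg (Nat.cast_nonneg _) (by linarith)
  rw [prod_one_add, selbergSum, selbergSum, sum_mul_sum, ← sum_product']
  calc ∑ s ∈ sieveFamily Pr y, ∏ p ∈ s, (κ : ℝ) / (p - κ)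
      = ∑ s ∈ sieveFamily Pr y,
          (∏ p ∈ s ∩ T, (κ : ℝ) / (p - κ)) * ∏ p ∈ s \ T, (κ : ℝ) / (p - κ) :=
        sum_congr rfl fun s _ => (prod_inter_mul_prod_sdiff s T _).symm
    _ = ∑ x ∈ (sieveFamily Pr y).image fun s => (s ∩ T, s \ T),
          (∏ p ∈ x.1, (κ : ℝ) / (p - κ)) * ∏ p ∈ x.2, (κ : ℝ) / (p - κ) := by
        rw [sum_image]
        intro s _ s' _ h
        simp only [Prod.mk.injEq] at h
        rw [← sdiff_union_inter s T, ← sdiff_union_inter s' T, h.1, h.2]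
    _ ≤ _ := by
        refine sum_le_sum_of_subset_of_nonneg ?_ fun x hx _ => ?_
        · intro x hx
          obtain ⟨s, hs, rfl⟩ := mem_image.1 hx
          obtain ⟨hs, hsy⟩ := mem_sieveFamily.1 hs
          refine mem_product.2 ⟨mem_powerset.2 inter_subset_right, mem_sieveFamily.2
            ⟨sdiff_subset_sdiff hs subset_rfl, le_trans ?_ hsy⟩⟩
          rw [← prod_inter_mul_prod_sdiff s T]
          refine le_mul_of_one_le_left (prod_nonneg fun p _ => Nat.cast_nonneg p)
            (one_le_prod fun p hp => ?_)
          exact_mod_cast (hprime p (hs (mem_inter.1 hp).1)).one_le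
        · obtain ⟨h1, h2⟩ := mem_product.1 hx
          exact mul_nonneg (hg _ ((mem_powerset.1 h1).trans hT))
            (hg _ ((mem_sieveFamily.1 h2).1.trans sdiff_subset))

theorem card_sieveFamily_le {Pr : Finset ℕ} (hprime : ∀ p ∈ Pr, p.Prime) {z : ℝ} (hz : 0 ≤ z) :
    (#(sieveFamily Pr z) : ℝ) ≤ z := by
  have h1 : #(sieveFamily Pr z) ≤ #(Ioc 0 ⌊z⌋₊) := by
    refine card_le_card_of_injOn (fun s => ∏ p ∈ s, p) ?_ ?_
    · intro s hs
      obtain ⟨hs, hsz⟩ := mem_sieveFamily.1 hs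
      rw [mem_coe, mem_Ioc]
      refine ⟨prod_pos fun p hp => (hprime p (hs hp)).pos, Nat.le_floor ?_⟩
      rwa [Nat.cast_prod]
    · intro s hs s' hs' h
      rw [← Nat.primeFactors_prod fun p hp => hprime p ((mem_sieveFamily.1 hs).1 hp),
        ← Nat.primeFactors_prod fun p hp => hprime p ((mem_sieveFamily.1 hs').1 hp)]
      exact congrArg Nat.primeFactors h
  rw [Nat.card_Ioc, Nat.sub_zero] at h1
  exact le_trans (by exact_mod_cast h1) (Nat.floor_le hz)

/-- The divisor-type bound `c ^ ω(l) ≪ l ^ ε`, summed over the squarefree `l ≤ z`. -/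
theorem exists_sum_pow_card_le (c : ℝ) (hc : 1 ≤ c) (ε : ℝ) (hε : 0 < ε) :
    ∃ C : ℝ, 0 < C ∧ ∀ (Pr : Finset ℕ), (∀ p ∈ Pr, p.Prime) → ∀ z : ℝ, 1 ≤ z →
      ∑ s ∈ sieveFamily Pr z, c ^ #s ≤ C * z ^ (1 + ε) := by
  obtain ⟨T, hT⟩ := exists_nat_ge (c ^ (1 / ε))
  refine ⟨c ^ T, by positivity, fun Pr hprime z hz => ?_⟩
  have hz0 : 0 < z := by linarith
  have h1 : ∀ s ∈ sieveFamily Pr z, c ^ #s ≤ c ^ T * z ^ ε := by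
    intro s hs
    obtain ⟨hs, hsz⟩ := mem_sieveFamily.1 hs
    have hsmall : c ^ #(s.filter (· < T)) ≤ c ^ T := by
      refine pow_le_pow_right₀ hc ?_
      refine (card_le_card (t := range T) fun p hp => ?_).trans_eq (card_range T)
      exact mem_range.2 (mem_filter.1 hp).2
    have hlarge : c ^ #(s.filter (¬ · < T)) ≤ z ^ ε := by
      rw [← prod_const]
      calc ∏ _p ∈ s with ¬ _p < T, c ≤ ∏ p ∈ s with ¬ p < T, (p : ℝ) ^ ε := by
            refine prod_le_prod (fun _ _ => by linarith) fun p hp => ?_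
            have hp' : (T : ℝ) ≤ p := by exact_mod_cast not_lt.1 (mem_filter.1 hp).2
            calc c = (c ^ (1 / ε)) ^ ε := by
                  rw [← Real.rpow_mul (by linarith), one_div_mul_cancel hε.ne', Real.rpow_one]
              _ ≤ _ := Real.rpow_le_rpow (by positivity) (hT.trans hp') hε.le
        _ ≤ ∏ p ∈ s, (p : ℝ) ^ ε := by
            refine prod_le_prod_of_subset_of_one_le (filter_subset _ _)
              (fun p _ => by positivity) fun p hp _ => ?_
            exact Real.one_le_rpow (by exact_mod_cast (hprime p (hs hp)).one_le) hε.le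
        _ = (∏ p ∈ s, (p : ℝ)) ^ ε := Real.finsetProd_rpow _ _ (fun p _ => Nat.cast_nonneg p) _
        _ ≤ z ^ ε := Real.rpow_le_rpow (prod_nonneg fun p _ => Nat.cast_nonneg p) hsz hε.le
    rw [← card_filter_add_card_filter_not (s := s) (· < T), pow_add]
    exact mul_le_mul hsmall hlarge (by positivity) (by positivity)
  calc _ ≤ ∑ _s ∈ sieveFamily Pr z, c ^ T * z ^ ε := sum_le_sum h1
    _ = #(sieveFamily Pr z) * (c ^ T * z ^ ε) := by rw [sum_const, nsmul_eq_mul]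
    _ ≤ z * (c ^ T * z ^ ε) :=
        mul_le_mul_of_nonneg_right (card_sieveFamily_le hprime hz0.le) (by positivity)
    _ = _ := by rw [Real.rpow_add hz0, Real.rpow_one]; ring

/-! ### The sieve for prime tuples -/

/-- The primes in `(W, z]`. -/
noncomputable def sievePrimes (W : ℕ) (z : ℝ) : Finset ℕ := {p ∈ Ioc W ⌊z⌋₊ | p.Prime}

/-- The primes in `Pr` modulo which two elements of `E` coincide. -/
def diffPrimes (Pr E : Finset ℕ) : Finset ℕ := {p ∈ Pr | ∃ x ∈ E, ∃ y ∈ E, x ≠ y ∧ x ≡ y [MOD p]}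

/-- The Euler factor lost when an `n`-tuple `E` is not sieved by the primes in `Pr` modulo which two
of its elements coincide. -/
noncomputable def diffWeight (n : ℕ) (Pr E : Finset ℕ) : ℝ :=
  ∏ p ∈ diffPrimes Pr E, (1 + (n : ℝ) / (p - n))

theorem mem_sievePrimes {W p : ℕ} {z : ℝ} :
    p ∈ sievePrimes W z ↔ (W < p ∧ p ≤ ⌊z⌋₊) ∧ p.Prime := by
  simp [sievePrimes]

/-- Selberg's sieve for prime tuples `m + x`, `x ∈ E`, with `m` in a residue class modulo `P`. -/
theorem card_prime_tuples_le (W P N a n : ℕ) (z : ℝ) (hz : 1 ≤ z) (hP : 0 < P)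
    (hPW : ∀ p : ℕ, p.Prime → p ∣ P → p ≤ W) (hn : 1 ≤ n) (hW : 2 * n ≤ W) (E : Finset ℕ)
    (hE : #E = n) :
    (#{m ∈ Ioc 0 N | m ≡ a [MOD P] ∧ z < m ∧ ∀ x ∈ E, (m + x).Prime} : ℝ) ≤
      N / P * (diffWeight n (sievePrimes W z) E / selbergSum n (sievePrimes W z) z)
        + (∑ s ∈ sieveFamily (sievePrimes W z) z, (2 * n : ℝ) ^ #s) ^ 2 := by
  set Pr := sievePrimes W z with hPr
  set T := diffPrimes Pr E with hT
  have hTPr : T ⊆ Pr := filter_subset _ _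
  have hprime : ∀ p ∈ Pr, p.Prime := fun p hp => (mem_sievePrimes.1 hp).2
  have hWp : ∀ p ∈ Pr, W < p := fun p hp => (mem_sievePrimes.1 hp).1.1
  have hnp : ∀ p ∈ Pr, 2 * (n : ℝ) < p := fun p hp => by
    exact_mod_cast hW.trans_lt (hWp p hp)
  have hn' : (1 : ℝ) ≤ n := by exact_mod_cast hn
  set D := sieveFamily (Pr \ T) z with hD
  set g : ℕ → ℝ := fun p => (n : ℝ) / (p - n) with hg_def
  have hDPr : ∀ s ∈ D, s ⊆ Pr \ T := fun s hs => (mem_sieveFamily.1 hs).1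
  have hDPr' : ∀ s ∈ D, s ⊆ Pr := fun s hs => (hDPr s hs).trans sdiff_subset
  have hgPr : ∀ p ∈ Pr, 0 < g p := fun p hp =>
    div_pos (by linarith) (by linarith [hnp p hp])
  have hg : ∀ p, (∃ s ∈ D, p ∈ s) → 0 < g p := fun p ⟨s, hs, hp⟩ => hgPr p (hDPr' s hs hp)
  have h0 : ∅ ∈ D := by
    rw [hD, mem_sieveFamily, prod_empty]
    exact ⟨empty_subset _, hz⟩
  have hdown : ∀ s ∈ D, ∀ t ⊆ s, t ∈ D := by
    intro s hs t hts
    obtain ⟨hs1, hs2⟩ := mem_sieveFamily.1 hs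
    refine mem_sieveFamily.2 ⟨hts.trans hs1, le_trans ?_ hs2⟩
    refine prod_le_prod_of_subset_of_one_le hts (fun p _ => Nat.cast_nonneg p) fun p hp _ => ?_
    exact_mod_cast (hprime p (hDPr' s hs hp)).one_le
  set bad : ℕ → Finset ℕ := fun m => {p ∈ Pr \ T | ∃ x ∈ E, p ∣ m + x} with hbad
  set A := {m ∈ Ioc 0 N | m ≡ a [MOD P]} with hA
  set R : ℕ → Finset ℕ := fun p => {ρ ∈ range p | ∃ x ∈ E, p ∣ ρ + x} with hR
  have hRcard : ∀ p ∈ Pr \ T, #(R p) = n := by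
    intro p hp
    obtain ⟨hpPr, hpT⟩ := mem_sdiff.1 hp
    rw [← hE]
    refine card_residues_dvd_add (hprime p hpPr).pos E fun x hx y hy hxy => ?_
    by_contra hne
    exact hpT (mem_filter.2 ⟨hpPr, x, hx, y, hy, hne, hxy⟩)
  have hcount : ∀ s ∈ D, ∀ t ∈ D,
      |(#{m ∈ A | s ∪ t ⊆ bad m} : ℝ) - N / P * ∏ p ∈ s ∪ t, g p / (1 + g p)|
        ≤ (n : ℝ) ^ #(s ∪ t) := by
    intro s hs t ht
    have hst : s ∪ t ⊆ Pr \ T := union_subset (hDPr s hs) (hDPr t ht)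
    have hstPr : ∀ p ∈ s ∪ t, p ∈ Pr := fun p hp => (mem_sdiff.1 (hst hp)).1
    have h1 := abs_card_residues_sub_le N R (s ∪ t) (fun p hp => hprime p (hstPr p hp))
      (fun p _ ρ hρ => mem_range.1 (mem_filter.1 hρ).1) P a hP fun p hp => by
        refine ((Nat.Prime.coprime_iff_not_dvd (hprime p (hstPr p hp))).2 fun h => ?_).symm
        exact absurd (hPW p (hprime p (hstPr p hp)) h) (not_le.2 (hWp p (hstPr p hp)))
    have h2 : {m ∈ A | s ∪ t ⊆ bad m}
        = {m ∈ Ioc 0 N | m ≡ a [MOD P] ∧ ∀ p ∈ s ∪ t, m % p ∈ R p} := by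
      rw [hA, filter_filter]
      refine filter_congr fun m _ => and_congr_right fun _ => ?_
      refine forall₂_congr fun p hp => ?_
      have hpos := (hprime p (hstPr p hp)).pos
      simp only [hbad, hR, mem_filter, hst hp, true_and, mem_range, Nat.mod_lt m hpos]
      refine exists_congr fun x => and_congr_right fun _ => ?_
      rw [Nat.dvd_iff_mod_eq_zero, Nat.dvd_iff_mod_eq_zero, Nat.mod_add_mod]
    have h3 : ∏ p ∈ s ∪ t, ((#(R p) : ℝ) / p) = ∏ p ∈ s ∪ t, g p / (1 + g p) := by
      refine prod_congr rfl fun p hp => ?_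
      rw [hRcard p (hst hp)]
      have h4 := hnp p (hstPr p hp)
      have h5 : (0 : ℝ) < p - n := by linarith
      have h6 : (0 : ℝ) < p := by linarith
      simp only [hg_def]
      have h7 : 1 + (n : ℝ) / (p - n) = p / (p - n) := by field_simp; ring
      rw [h7]
      field_simp
    have h4 : ∏ p ∈ s ∪ t, (#(R p) : ℝ) = (n : ℝ) ^ #(s ∪ t) := by
      rw [← prod_const]
      exact prod_congr rfl fun p hp => by rw [hRcard p (hst hp)]
    rwa [h2, ← h3, ← h4]
  have hsieve := selberg_sieve A bad ((N : ℝ) / P) n hn' hg h0 hdown hcount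
  have hsub : (#{m ∈ Ioc 0 N | m ≡ a [MOD P] ∧ z < m ∧ ∀ x ∈ E, (m + x).Prime} : ℝ)
      ≤ #{m ∈ A | ∀ s ∈ D, ∀ p ∈ s, p ∉ bad m} := by
    refine Nat.cast_le.2 (card_le_card fun m hm => ?_)
    obtain ⟨hm, hma, hmz, hmE⟩ := mem_filter.1 hm
    refine mem_filter.2 ⟨mem_filter.2 ⟨hm, hma⟩, fun s hs p hp hpb => ?_⟩
    obtain ⟨-, x, hx, hd⟩ := mem_filter.1 hpb
    have hpPr := hDPr' s hs hp
    have h1 : p = m + x := (Nat.prime_dvd_prime_iff_eq (hprime p hpPr) (hmE x hx)).1 hd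
    have h2 : (p : ℝ) ≤ z :=
      le_trans (by exact_mod_cast (mem_sievePrimes.1 hpPr).1.2) (Nat.floor_le (by linarith))
    have h3 : (m : ℝ) ≤ p := by rw [h1]; push_cast; linarith [Nat.cast_nonneg (α := ℝ) x]
    linarith
  refine hsub.trans (hsieve.trans (add_le_add ?_ ?_))
  · have hJ : 0 < ∑ u ∈ D, ∏ p ∈ u, g p := sum_prod_pos hg h0
    have h1 : selbergSum n Pr z ≤ diffWeight n Pr E * ∑ u ∈ D, ∏ p ∈ u, g p :=
      selbergSum_le_prod_mul (fun p hp => by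
        have := hnp p hp
        have h3 : (n : ℝ) < p := by linarith
        exact_mod_cast h3) hTPr hprime z
    have h2 : 0 < selbergSum n Pr z := sum_prod_pos
      (fun p ⟨s, hs, hp⟩ => hgPr p ((mem_sieveFamily.1 hs).1 hp))
      (mem_sieveFamily.2 ⟨empty_subset _, by rwa [prod_empty]⟩)
    rw [div_eq_mul_inv]
    refine mul_le_mul_of_nonneg_left ?_ (by positivity)
    rw [inv_eq_one_div, div_le_div_iff₀ hJ h2]
    linarith
  · have h1 : ∀ s ∈ D, ∏ p ∈ s, ((n : ℝ) * (1 + g p)) ≤ (2 * n : ℝ) ^ #s := by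
      intro s hs
      rw [← prod_const]
      refine prod_le_prod (fun p hp => ?_) fun p hp => ?_
      · have := hgPr p (hDPr' s hs hp)
        positivity
      · have h2 := hnp p (hDPr' s hs hp)
        have h3 : g p ≤ 1 := by
          simp only [hg_def]
          rw [div_le_one (by linarith)]
          linarith
        nlinarith
    refine pow_le_pow_left₀ (sum_nonneg fun s hs => prod_nonneg fun p hp => ?_)
      ((sum_le_sum h1).trans (sum_le_sum_of_subset_of_nonneg ?_ fun s _ _ => by positivity)) 2
    · have := hgPr p (hDPr' s hs hp)
      positivity
    · intro s hs
      obtain ⟨hs1, hs2⟩ := mem_sieveFamily.1 hs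
      exact mem_sieveFamily.2 ⟨hs1.trans sdiff_subset, hs2⟩

/-! ### Sums over tuples and the average of the singular series -/

/-- The sum of `F (E ∪ {x₁, …, x_r})` over ordered `r`-tuples of distinct elements of `S` outside
`E`. -/
noncomputable def tupleSum (S : Finset ℕ) (F : Finset ℕ → ℝ) : ℕ → Finset ℕ → ℝ
  | 0, E => F E
  | r + 1, E => ∑ x ∈ S \ E, tupleSum S F r (insert x E)

theorem tupleSum_sum {α : Type*} (S : Finset ℕ) (A : Finset α) (F : α → Finset ℕ → ℝ) (r : ℕ) :
    ∀ E, tupleSum S (fun E => ∑ m ∈ A, F m E) r E = ∑ m ∈ A, tupleSum S (F m) r E := by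
  induction r with
  | zero => intro E; rfl
  | succ r ih =>
    intro E
    simp only [tupleSum]
    rw [sum_comm]
    exact sum_congr rfl fun x _ => ih _

/-- The number of ordered `r`-tuples of distinct elements satisfying `q` is a falling factorial. -/
theorem tupleSum_indicator (S : Finset ℕ) (q : ℕ → Prop) [DecidablePred q] (r : ℕ) :
    ∀ E, tupleSum S (fun E => if ∀ x ∈ E, q x then 1 else 0) r E
      = if ∀ x ∈ E, q x then ((#{x ∈ S \ E | q x}).descFactorial r : ℝ) else 0 := by
  induction r with
  | zero => intro E; simp [tupleSum]
  | succ r ih =>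
    intro E
    simp only [tupleSum, ih, forall_mem_insert]
    by_cases hE : ∀ x ∈ E, q x
    · rw [if_pos hE]
      have h1 : ∀ x ∈ S \ E, (if q x ∧ ∀ x ∈ E, q x then
          ((#{y ∈ S \ insert x E | q y}).descFactorial r : ℝ) else 0)
          = if q x then (((#{x ∈ S \ E | q x}) - 1).descFactorial r : ℝ) else 0 := by
        intro x hx
        by_cases hq : q x
        · rw [if_pos ⟨hq, hE⟩, if_pos hq]
          have : {y ∈ S \ insert x E | q y} = {y ∈ S \ E | q y}.erase x := by
            ext y
            simp only [mem_filter, mem_sdiff, mem_insert, mem_erase]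
            tauto
          rw [this, card_erase_of_mem (mem_filter.2 ⟨hx, hq⟩)]
        · rw [if_neg (fun h => hq h.1), if_neg hq]
      rw [sum_congr rfl h1, ← sum_filter, sum_const, nsmul_eq_mul]
      rcases Nat.eq_zero_or_pos #{x ∈ S \ E | q x} with h | h
      · rw [h]; simp
      · obtain ⟨c, hc⟩ := Nat.exists_eq_succ_of_ne_zero h.ne'
        rw [hc, Nat.succ_descFactorial_succ]
        push_cast
        simp
    · rw [if_neg hE]
      exact sum_eq_zero fun x _ => if_neg fun h => hE h.2

/-- If adjoining a further element of `S` multiplies the total weight `w` by at most `B`, the sum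
over `r`-tuples multiplies it by at most `B ^ r`. -/
theorem tupleSum_le (S U : Finset ℕ) (hS : S ⊆ U) (F w : Finset ℕ → ℝ) (α B R : ℝ) (hα : 0 ≤ α)
    (hB : 0 ≤ B) (hR : 0 ≤ R) (n : ℕ)
    (hw : ∀ E ⊆ U, #E < n → ∑ x ∈ S \ E, w (insert x E) ≤ B * w E)
    (hF : ∀ E ⊆ U, #E = n → F E ≤ α * w E + R) (r : ℕ) :
    ∀ E ⊆ U, #E + r = n → tupleSum S F r E ≤ α * B ^ r * w E + R * (#S : ℝ) ^ r := by
  induction r with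
  | zero =>
    intro E hE hn
    simpa [tupleSum] using hF E hE hn
  | succ r ih =>
    intro E hE hn
    calc tupleSum S F (r + 1) E = ∑ x ∈ S \ E, tupleSum S F r (insert x E) := rfl
      _ ≤ ∑ x ∈ S \ E, (α * B ^ r * w (insert x E) + R * (#S : ℝ) ^ r) := by
          refine sum_le_sum fun x hx => ?_
          obtain ⟨hxS, hxE⟩ := mem_sdiff.1 hx
          refine ih _ (insert_subset (hS hxS) hE) ?_
          rw [card_insert_of_notMem hxE]
          omega
      _ = α * B ^ r * ∑ x ∈ S \ E, w (insert x E) + #(S \ E) * (R * (#S : ℝ) ^ r) := by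
          rw [sum_add_distrib, ← mul_sum, sum_const, nsmul_eq_mul]
      _ ≤ α * B ^ r * (B * w E) + #S * (R * (#S : ℝ) ^ r) := by
          refine add_le_add (mul_le_mul_of_nonneg_left (hw E hE (by omega)) (by positivity)) ?_
          refine mul_le_mul_of_nonneg_right ?_ (by positivity)
          exact_mod_cast card_le_card sdiff_subset
      _ = _ := by ring

theorem prod_biUnion_le_prod_prod {α : Type*} (E : Finset α) (t : α → Finset ℕ) (f : ℕ → ℝ)
    (hf : ∀ y ∈ E, ∀ p ∈ t y, 1 ≤ f p) [DecidableEq α] :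
    ∏ p ∈ E.biUnion t, f p ≤ ∏ y ∈ E, ∏ p ∈ t y, f p := by
  induction E using Finset.induction_on with
  | empty => simp
  | insert y E hy ih =>
    have h1 := ih fun z hz => hf z (mem_insert_of_mem hz)
    have hy1 := hf y (mem_insert_self y E)
    have h3 : ∀ p ∈ E.biUnion t, 1 ≤ f p := fun p hp => by
      obtain ⟨z, hz, hp⟩ := mem_biUnion.1 hp
      exact hf z (mem_insert_of_mem hz) p hp
    rw [biUnion_insert, prod_insert hy]
    calc ∏ p ∈ t y ∪ E.biUnion t, f p
        ≤ (∏ p ∈ t y ∪ E.biUnion t, f p) * ∏ p ∈ t y ∩ E.biUnion t, f p := by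
          refine le_mul_of_one_le_right (prod_nonneg fun p hp => ?_)
            (one_le_prod fun p hp => hy1 p (mem_inter.1 hp).1)
          rcases mem_union.1 hp with hp | hp
          · linarith [hy1 p hp]
          · linarith [h3 p hp]
      _ = (∏ p ∈ t y, f p) * ∏ p ∈ E.biUnion t, f p := prod_union_inter
      _ ≤ _ := mul_le_mul_of_nonneg_left h1 (prod_nonneg fun p hp => by linarith [hy1 p hp])

/-- The product is at most the `n`-th power of its largest factor. -/
theorem prod_le_one_add_sum {α : Type*} (E : Finset α) (A : α → ℝ) (hA : ∀ y ∈ E, 1 ≤ A y)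
    {n : ℕ} (hn : #E ≤ n) : ∏ y ∈ E, A y ≤ 1 + ∑ y ∈ E, (A y ^ n - 1) := by
  rcases E.eq_empty_or_nonempty with rfl | hE
  · simp
  obtain ⟨y₀, hy₀, hmax⟩ := exists_max_image E A hE
  have h1 : ∏ y ∈ E, A y ≤ A y₀ ^ n := by
    calc ∏ y ∈ E, A y ≤ ∏ _y ∈ E, A y₀ :=
          prod_le_prod (fun y hy => by linarith [hA y hy]) hmax
      _ = A y₀ ^ #E := prod_const _
      _ ≤ _ := pow_le_pow_right₀ (hA y₀ hy₀) hn
  have h2 : A y₀ ^ n - 1 ≤ ∑ y ∈ E, (A y ^ n - 1) :=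
    single_le_sum (f := fun y => A y ^ n - 1)
      (fun y hy => sub_nonneg.2 (one_le_pow₀ (hA y hy))) hy₀
  linarith

theorem card_modEq_ne_le (q h y : ℕ) (hq : 0 < q) (hy : y ≤ h) :
    (#{x ∈ Icc 1 h | x ≠ y ∧ x ≡ y [MOD q]} : ℝ) ≤ 2 * h / q := by
  have h1 : #{x ∈ Icc 1 h | y < x ∧ x ≡ y [MOD q]} ≤ #(Ioc 0 (h / q)) := by
    refine card_le_card_of_injOn (fun x => (x - y) / q) ?_ ?_
    · intro x hx
      obtain ⟨hx1, hx2, hx3⟩ := mem_filter.1 (mem_coe.1 hx)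
      have hd : q ∣ x - y := (Nat.modEq_iff_dvd' hx2.le).1 hx3.symm
      rw [mem_coe, mem_Ioc]
      refine ⟨Nat.div_pos (Nat.le_of_dvd (by omega) hd) hq, Nat.div_le_div_right ?_⟩
      have := (mem_Icc.1 hx1).2
      omega
    · intro x hx x' hx' e
      obtain ⟨hx1, hx2, hx3⟩ := mem_filter.1 (mem_coe.1 hx)
      obtain ⟨hx1', hx2', hx3'⟩ := mem_filter.1 (mem_coe.1 hx')
      have hd : q ∣ x - y := (Nat.modEq_iff_dvd' hx2.le).1 hx3.symm
      have hd' : q ∣ x' - y := (Nat.modEq_iff_dvd' hx2'.le).1 hx3'.symm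
      have := Nat.div_left_inj hd hd' |>.1 e
      omega
  have h2 : #{x ∈ Icc 1 h | x < y ∧ x ≡ y [MOD q]} ≤ #(Ioc 0 (h / q)) := by
    refine card_le_card_of_injOn (fun x => (y - x) / q) ?_ ?_
    · intro x hx
      obtain ⟨hx1, hx2, hx3⟩ := mem_filter.1 (mem_coe.1 hx)
      have hd : q ∣ y - x := (Nat.modEq_iff_dvd' hx2.le).1 hx3
      rw [mem_coe, mem_Ioc]
      refine ⟨Nat.div_pos (Nat.le_of_dvd (by omega) hd) hq, Nat.div_le_div_right ?_⟩
      omega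
    · intro x hx x' hx' e
      obtain ⟨hx1, hx2, hx3⟩ := mem_filter.1 (mem_coe.1 hx)
      obtain ⟨hx1', hx2', hx3'⟩ := mem_filter.1 (mem_coe.1 hx')
      have hd : q ∣ y - x := (Nat.modEq_iff_dvd' hx2.le).1 hx3
      have hd' : q ∣ y - x' := (Nat.modEq_iff_dvd' hx2'.le).1 hx3'
      have := Nat.div_left_inj hd hd' |>.1 e
      omega
  rw [Nat.card_Ioc, Nat.sub_zero] at h1 h2
  have h3 : #{x ∈ Icc 1 h | x ≠ y ∧ x ≡ y [MOD q]} ≤ h / q + h / q := by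
    refine le_trans (card_le_card ?_) ((card_union_le _ _).trans (add_le_add h1 h2))
    intro x hx
    obtain ⟨hx1, hx2, hx3⟩ := mem_filter.1 hx
    rw [mem_union, mem_filter, mem_filter]
    rcases lt_or_gt_of_ne hx2 with h | h
    · exact Or.inr ⟨hx1, h, hx3⟩
    · exact Or.inl ⟨hx1, h, hx3⟩
  have h4 : ((h / q : ℕ) : ℝ) ≤ h / q := Nat.cast_div_le
  have h5 : (#{x ∈ Icc 1 h | x ≠ y ∧ x ≡ y [MOD q]} : ℝ) ≤ (h / q : ℕ) + (h / q : ℕ) := by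
    exact_mod_cast h3
  calc _ ≤ _ := h5
    _ ≤ (h : ℝ) / q + h / q := by linarith
    _ = _ := by ring

/-- Average over `x ≤ h`, `x ≠ y`, of the excess over `1` of a product over the primes in `Pr`
dividing `x - y`. -/
theorem sum_prod_modEq_sub_one_le (Pr : Finset ℕ) (hprime : ∀ p ∈ Pr, p.Prime) (c : ℕ → ℝ)
    (hc : ∀ p ∈ Pr, 0 ≤ c p) (h y : ℕ) (hy : y ≤ h) :
    ∑ x ∈ Icc 1 h with x ≠ y, (∏ p ∈ Pr with x ≡ y [MOD p], (1 + c p) - 1)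
      ≤ 2 * h * (∏ p ∈ Pr, (1 + c p / p) - 1) := by
  have hexp : ∀ (Q : Finset ℕ) (f : ℕ → ℝ),
      ∏ p ∈ Q, (1 + f p) - 1 = ∑ s ∈ Q.powerset.erase ∅, ∏ p ∈ s, f p := by
    intro Q f
    rw [prod_one_add, ← add_sum_erase _ _ (empty_mem_powerset Q), prod_empty]
    ring
  have hcs : ∀ s ∈ Pr.powerset.erase ∅, 0 ≤ ∏ p ∈ s, c p := fun s hs =>
    prod_nonneg fun p hp => hc p (mem_powerset.1 (mem_of_mem_erase hs) hp)
  rw [hexp Pr, mul_sum]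
  calc ∑ x ∈ Icc 1 h with x ≠ y, (∏ p ∈ Pr with x ≡ y [MOD p], (1 + c p) - 1)
      = ∑ x ∈ Icc 1 h with x ≠ y, ∑ s ∈ Pr.powerset.erase ∅,
          if ∀ p ∈ s, x ≡ y [MOD p] then ∏ p ∈ s, c p else 0 := by
        refine sum_congr rfl fun x _ => ?_
        rw [hexp, ← sum_filter]
        refine sum_congr ?_ fun _ _ => rfl
        ext s
        simp only [mem_erase, mem_powerset, mem_filter, subset_iff]
        constructor
        · rintro ⟨h1, h2⟩
          exact ⟨⟨h1, fun p hp => (h2 hp).1⟩, fun p hp => (h2 hp).2⟩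
        · rintro ⟨⟨h1, h2⟩, h3⟩
          exact ⟨h1, fun p hp => ⟨h2 hp, h3 p hp⟩⟩
    _ = ∑ s ∈ Pr.powerset.erase ∅,
          #{x ∈ Icc 1 h | x ≠ y ∧ ∀ p ∈ s, x ≡ y [MOD p]} * ∏ p ∈ s, c p := by
        rw [sum_comm]
        refine sum_congr rfl fun s _ => ?_
        rw [← sum_filter, filter_filter, sum_const, nsmul_eq_mul]
    _ ≤ ∑ s ∈ Pr.powerset.erase ∅, 2 * (h : ℝ) * ∏ p ∈ s, (c p / p) := by
        refine sum_le_sum fun s hs => ?_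
        have hsPr := mem_powerset.1 (mem_of_mem_erase hs)
        have h1 : {x ∈ Icc 1 h | x ≠ y ∧ ∀ p ∈ s, x ≡ y [MOD p]}
            ⊆ {x ∈ Icc 1 h | x ≠ y ∧ x ≡ y [MOD ∏ p ∈ s, p]} := by
          intro x hx
          obtain ⟨hx1, hx2, hx3⟩ := mem_filter.1 hx
          refine mem_filter.2 ⟨hx1, hx2, ?_⟩
          rw [Nat.modEq_iff_dvd, Nat.cast_prod]
          refine Finset.prod_dvd_of_coprime (fun p hp q hq hpq => ?_)
            fun p hp => Nat.modEq_iff_dvd.1 (hx3 p hp)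
          exact Nat.isCoprime_iff_coprime.2
            ((Nat.coprime_primes (hprime p (hsPr hp)) (hprime q (hsPr hq))).2 hpq)
        have h2 := card_modEq_ne_le (∏ p ∈ s, p) h y
          (prod_pos fun p hp => (hprime p (hsPr hp)).pos) hy
        rw [prod_div_distrib, ← Nat.cast_prod]
        calc _ ≤ 2 * (h : ℝ) / (∏ p ∈ s, p : ℕ) * ∏ p ∈ s, c p :=
              mul_le_mul_of_nonneg_right
                (le_trans (by exact_mod_cast card_le_card h1) h2) (hcs s hs)
          _ = _ := by ring

theorem sum_inv_sq_le (W M : ℕ) (hW : 0 < W) :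
    ∑ p ∈ Ioc W M, 1 / (p : ℝ) ^ 2 ≤ 1 / (W : ℝ) := by
  rcases le_total W M with h | h
  · suffices ∑ p ∈ Ioc W M, 1 / (p : ℝ) ^ 2 ≤ 1 / (W : ℝ) - 1 / (M : ℝ) by
      have h1 : (0 : ℝ) ≤ 1 / (M : ℝ) := by positivity
      linarith
    induction M, h using Nat.le_induction with
    | base => simp
    | succ M hM ih =>
      rw [sum_Ioc_succ_top hM]
      have hM0 : (0 : ℝ) < M := by exact_mod_cast hW.trans_le hM
      have h1 : 1 / ((M + 1 : ℕ) : ℝ) ^ 2 ≤ 1 / M - 1 / (M + 1 : ℕ) := by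
        push_cast
        rw [div_sub_div _ _ hM0.ne' (by positivity), div_le_div_iff₀ (by positivity) (by positivity)]
        nlinarith
      linarith
  · rw [Ioc_eq_empty_of_le h, sum_empty]
    positivity

theorem one_add_pow_sub_one_le (n : ℕ) {u : ℝ} (h0 : 0 ≤ u) (h1 : u ≤ 1) :
    (1 + u) ^ n - 1 ≤ n * 2 ^ n * u := by
  induction n with
  | zero => simp
  | succ n ih =>
    have h2 : (1 + u) ^ n ≤ 2 ^ n := pow_le_pow_left₀ (by linarith) (by linarith) n
    have h3 : (1 + u) ^ (n + 1) - 1 = ((1 + u) ^ n - 1) + (1 + u) ^ n * u := by ring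
    rw [h3, pow_succ]
    push_cast
    have h4 : (1 + u) ^ n * u ≤ 2 ^ n * u := mul_le_mul_of_nonneg_right h2 h0
    have h5 : 0 ≤ (n : ℝ) * 2 ^ n * u := by positivity
    have h6 : 0 ≤ (2 : ℝ) ^ n * u := by positivity
    nlinarith

theorem sum_diffWeight_insert_le (n W h : ℕ) (z : ℝ) (hn : 1 ≤ n) (hW : 2 * n ≤ W)
    (hCW : 2 * (n : ℝ) ^ 2 * 2 ^ n ≤ W) (S E : Finset ℕ) (hS : S ⊆ Icc 1 h)
    (hE : E ⊆ range (h + 1)) (hEn : #E ≤ n) :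
    ∑ x ∈ S \ E, diffWeight n (sievePrimes W z) (insert x E)
      ≤ (#S + n * (2 * h * (2 * (2 * (n : ℝ) ^ 2 * 2 ^ n / W)))) *
        diffWeight n (sievePrimes W z) E := by
  set Pr := sievePrimes W z with hPr
  set g : ℕ → ℝ := fun p => (n : ℝ) / (p - n) with hg_def
  have hprime : ∀ p ∈ Pr, p.Prime := fun p hp => (mem_sievePrimes.1 hp).2
  have hn' : (1 : ℝ) ≤ n := by exact_mod_cast hn
  have hW0 : (0 : ℝ) < W := by exact_mod_cast (by omega : 0 < W)
  have hnp : ∀ p ∈ Pr, 2 * (n : ℝ) < p := fun p hp => by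
    exact_mod_cast hW.trans_lt (mem_sievePrimes.1 hp).1.1
  have hg0 : ∀ p ∈ Pr, 0 ≤ g p := fun p hp =>
    div_nonneg (by linarith) (by linarith [hnp p hp])
  set C : ℝ := 2 * (n : ℝ) ^ 2 * 2 ^ n with hC
  have hC0 : 0 < C := by positivity
  set c : ℕ → ℝ := fun p => (1 + g p) ^ n - 1 with hc_def
  have hc0 : ∀ p ∈ Pr, 0 ≤ c p := fun p hp =>
    sub_nonneg.2 (one_le_pow₀ (by linarith [hg0 p hp]))
  have hcp : ∀ p ∈ Pr, c p / p ≤ C * (1 / (p : ℝ) ^ 2) := by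
    intro p hp
    have h1 := hnp p hp
    have hp0 : (0 : ℝ) < p := by linarith
    have h2 : g p ≤ 2 * n / p := by
      simp only [hg_def]
      rw [div_le_div_iff₀ (by linarith) hp0]
      nlinarith
    have h3 : g p ≤ 1 := h2.trans ((div_le_one hp0).2 h1.le)
    have h4 := one_add_pow_sub_one_le n (hg0 p hp) h3
    rw [div_le_iff₀ hp0]
    calc c p ≤ n * 2 ^ n * g p := h4
      _ ≤ n * 2 ^ n * (2 * n / p) := mul_le_mul_of_nonneg_left h2 (by positivity)
      _ = _ := by rw [hC]; field_simp
  have htail : ∏ p ∈ Pr, (1 + c p / p) - 1 ≤ 2 * (C / W) := by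
    have h1 : ∑ p ∈ Pr, c p / p ≤ C / W := by
      calc _ ≤ ∑ p ∈ Pr, C * (1 / (p : ℝ) ^ 2) := sum_le_sum hcp
        _ = C * ∑ p ∈ Pr, 1 / (p : ℝ) ^ 2 := by rw [mul_sum]
        _ ≤ C * ∑ p ∈ Ioc W ⌊z⌋₊, 1 / (p : ℝ) ^ 2 := by
            refine mul_le_mul_of_nonneg_left ?_ hC0.le
            exact sum_le_sum_of_subset_of_nonneg (filter_subset _ _) fun p _ _ => by positivity
        _ ≤ C * (1 / W) :=
            mul_le_mul_of_nonneg_left (sum_inv_sq_le W _ (by omega)) hC0.le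
        _ = _ := by ring
    have h2 : ∏ p ∈ Pr, (1 + c p / p) ≤ Real.exp (∑ p ∈ Pr, c p / p) := by
      rw [Real.exp_sum]
      refine prod_le_prod (fun p hp => ?_) fun p _ => ?_
      · have := hc0 p hp
        positivity
      · rw [add_comm]
        exact Real.add_one_le_exp _
    have h3 : C / W ≤ 1 := (div_le_one hW0).2 hCW
    have h4 : Real.exp (C / W) - 1 ≤ 2 * (C / W) := by
      have h5 := Real.abs_exp_sub_one_le (x := C / W) (by rwa [abs_of_pos (by positivity)])
      rw [abs_of_pos (show 0 < C / W by positivity)] at h5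
      exact (le_abs_self _).trans h5
    linarith [Real.exp_le_exp.2 h1]
  have hwE : 0 ≤ diffWeight n Pr E := prod_nonneg fun p hp => by
    have := hg0 p (mem_filter.1 hp).1
    simp only [hg_def] at this
    linarith
  have hins : ∀ x ∈ S \ E, diffWeight n Pr (insert x E) ≤
      (1 + ∑ y ∈ E, (∏ p ∈ Pr with x ≡ y [MOD p], (1 + c p) - 1)) * diffWeight n Pr E := by
    intro x hx
    have h1 : diffPrimes Pr (insert x E)
        ⊆ (diffPrimes Pr E) ∪ E.biUnion fun y => {p ∈ Pr | x ≡ y [MOD p]} := by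
      intro p hp
      obtain ⟨hpPr, u, hu, v, hv, huv, hmod⟩ := mem_filter.1 hp
      rw [mem_union, mem_biUnion]
      rcases mem_insert.1 hu with hux | huE <;> rcases mem_insert.1 hv with hvx | hvE
      · exact absurd (hux.trans hvx.symm) huv
      · exact Or.inr ⟨v, hvE, mem_filter.2 ⟨hpPr, hux ▸ hmod⟩⟩
      · exact Or.inr ⟨u, huE, mem_filter.2 ⟨hpPr, hvx ▸ hmod.symm⟩⟩
      · exact Or.inl (mem_filter.2 ⟨hpPr, u, huE, v, hvE, huv, hmod⟩)
    have h1g : ∀ p ∈ Pr, 1 ≤ 1 + g p := fun p hp => by linarith [hg0 p hp]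
    have hB : ∀ p ∈ E.biUnion fun y => {p ∈ Pr | x ≡ y [MOD p]}, p ∈ Pr := fun p hp => by
      obtain ⟨y, _, hp⟩ := mem_biUnion.1 hp
      exact (mem_filter.1 hp).1
    have hD : ∀ p ∈ diffPrimes Pr E, p ∈ Pr := fun p hp => (mem_filter.1 hp).1
    have h2 : ∏ p ∈ E.biUnion fun y => {p ∈ Pr | x ≡ y [MOD p]}, (1 + g p)
        ≤ 1 + ∑ y ∈ E, (∏ p ∈ Pr with x ≡ y [MOD p], (1 + c p) - 1) := by
      refine (prod_biUnion_le_prod_prod E _ _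
        fun y _ p hp => h1g p (mem_filter.1 hp).1).trans ?_
      refine (prod_le_one_add_sum E _ (fun y _ => one_le_prod fun p hp =>
        h1g p (mem_filter.1 hp).1) hEn).trans_eq ?_
      simp only [hc_def, add_sub_cancel, prod_pow]
    calc diffWeight n Pr (insert x E)
        ≤ ∏ p ∈ (diffPrimes Pr E) ∪ E.biUnion fun y => {p ∈ Pr | x ≡ y [MOD p]}, (1 + g p) := by
          refine prod_le_prod_of_subset_of_one_le h1 (fun p hp => ?_) fun p hp _ => ?_
          · linarith [h1g p (mem_filter.1 hp).1]
          · rcases mem_union.1 hp with hp | hp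
            · exact h1g p (hD p hp)
            · exact h1g p (hB p hp)
      _ ≤ (∏ p ∈ diffPrimes Pr E, (1 + g p)) *
          ∏ p ∈ E.biUnion fun y => {p ∈ Pr | x ≡ y [MOD p]}, (1 + g p) := by
          rw [← prod_union_inter]
          refine le_mul_of_one_le_right (prod_nonneg fun p hp => ?_)
            (one_le_prod fun p hp => h1g p (hD p (mem_inter.1 hp).1))
          rcases mem_union.1 hp with hp | hp
          · linarith [h1g p (hD p hp)]
          · linarith [h1g p (hB p hp)]
      _ ≤ _ := by
          rw [mul_comm]
          exact mul_le_mul_of_nonneg_right h2 hwE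
  calc ∑ x ∈ S \ E, diffWeight n Pr (insert x E)
      ≤ ∑ x ∈ S \ E, (1 + ∑ y ∈ E, (∏ p ∈ Pr with x ≡ y [MOD p], (1 + c p) - 1))
          * diffWeight n Pr E := sum_le_sum hins
    _ = (#(S \ E) + ∑ y ∈ E, ∑ x ∈ S \ E, (∏ p ∈ Pr with x ≡ y [MOD p], (1 + c p) - 1))
          * diffWeight n Pr E := by
        rw [← sum_mul, sum_add_distrib, sum_const, nsmul_eq_mul, mul_one, sum_comm]
    _ ≤ _ := by
        refine mul_le_mul_of_nonneg_right (add_le_add ?_ ?_) hwE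
        · exact_mod_cast card_le_card sdiff_subset
        · calc _ ≤ ∑ _y ∈ E, 2 * (h : ℝ) * (2 * (C / W)) := by
                refine sum_le_sum fun y hy => ?_
                have hyh : y ≤ h := by
                  have := mem_range.1 (hE hy)
                  omega
                refine le_trans ?_ ((sum_prod_modEq_sub_one_le Pr hprime c hc0 h y hyh).trans
                  (mul_le_mul_of_nonneg_left htail (by positivity)))
                refine sum_le_sum_of_subset_of_nonneg ?_ fun x _ _ => ?_
                · intro x hx
                  obtain ⟨hxS, hxE⟩ := mem_sdiff.1 hx
                  exact mem_filter.2 ⟨hS hxS, fun h => hxE (h ▸ hy)⟩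
                · exact sub_nonneg.2 (one_le_prod fun p hp => by
                    linarith [hc0 p (mem_filter.1 hp).1])
            _ = #E * (2 * (h : ℝ) * (2 * (C / W))) := by rw [sum_const, nsmul_eq_mul]
            _ ≤ _ := by
                refine mul_le_mul_of_nonneg_right (by exact_mod_cast hEn) ?_
                positivity

/-! ### Factorial moments with fixed sieve parameters -/

theorem primorial_succ_of_prime {N : ℕ} (h : (N + 1).Prime) :
    primorial (N + 1) = (N + 1) * primorial N := by
  rw [primorial, range_add_one, filter_insert, if_pos h, prod_insert (by simp), primorial]

theorem primorial_succ_of_not_prime {N : ℕ} (h : ¬ (N + 1).Prime) :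
    primorial (N + 1) = primorial N := by
  rw [primorial, range_add_one, filter_insert, if_neg h, primorial]

/-- `∏_{p ≤ W} (1 - 1 / p) ≫ W ^ (-1/2)`, by comparing with the product over `2` and all odd
numbers. -/
theorem totient_primorial_ge (K : ℕ) :
    1 / (2 * √(2 * K + 1)) ≤
      ((primorial (2 * K + 2)).totient : ℝ) / primorial (2 * K + 2) := by
  induction K with
  | zero => norm_num
  | succ K ih =>
    have h4 : ¬ (2 * K + 3 + 1).Prime := fun h => by
      have := h.eq_one_or_self_of_dvd 2 ⟨K + 2, by ring⟩
      omega
    have e : 2 * (K + 1) + 2 = 2 * K + 3 + 1 := by ring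
    rw [e, primorial_succ_of_not_prime h4]
    have hpos : (0 : ℝ) < primorial (2 * K + 2) := by exact_mod_cast primorial_pos _
    have hmono : 1 / (2 * √(2 * (K + 1 : ℕ) + 1)) ≤
        ((2 * K + 2 : ℝ) / (2 * K + 3)) * (1 / (2 * √(2 * K + 1))) := by
      have h1 : √(2 * K + 1 : ℝ) * (2 * K + 3) ≤ √(2 * (K + 1 : ℕ) + 1 : ℝ) * (2 * K + 2) := by
        refine (sq_le_sq₀ (by positivity) (by positivity)).1 ?_
        rw [mul_pow, mul_pow, Real.sq_sqrt (by positivity), Real.sq_sqrt (by positivity)]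
        push_cast
        nlinarith [Nat.cast_nonneg (α := ℝ) K]
      rw [div_mul_div_comm, div_le_div_iff₀ (by positivity) (by positivity)]
      nlinarith
    have hK : (0 : ℝ) ≤ (2 * K + 2) / (2 * K + 3) := by positivity
    by_cases h3 : (2 * K + 2 + 1).Prime
    · have hcop : (2 * K + 2 + 1).Coprime (primorial (2 * K + 2)) := by
        rw [h3.coprime_iff_not_dvd, h3.dvd_primorial_iff]
        omega
      rw [show 2 * K + 3 = 2 * K + 2 + 1 by ring, primorial_succ_of_prime h3,
        Nat.totient_mul hcop, Nat.totient_prime h3]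
      refine hmono.trans ((mul_le_mul_of_nonneg_left ih hK).trans_eq ?_)
      rw [Nat.add_sub_cancel]
      push_cast
      rw [div_mul_div_comm]
      congr 2
      ring
    · rw [show 2 * K + 3 = 2 * K + 2 + 1 by ring, primorial_succ_of_not_prime h3]
      refine hmono.trans ((mul_le_mul_of_nonneg_left ih hK).trans ?_)
      refine mul_le_of_le_one_left (by positivity) ?_
      rw [div_le_one (by positivity)]
      linarith

theorem card_coprime_add_le (P a H : ℕ) (hP : 0 < P) :
    (#{d ∈ Icc 1 H | P.Coprime (a + d)} : ℝ) ≤ P.totient * (H / P + 1 : ℝ) := by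
  have h1 : #{d ∈ Icc 1 H | P.Coprime (a + d)} ≤ #{x ∈ Ico (a + 1) (a + 1 + H) | P.Coprime x} := by
    refine card_le_card_of_injOn (a + ·) ?_ fun x _ y _ h => Nat.add_left_cancel h
    intro d hd
    obtain ⟨hd1, hd2⟩ := mem_filter.1 (mem_coe.1 hd)
    rw [mem_Icc] at hd1
    exact mem_coe.2 (mem_filter.2 ⟨mem_Ico.2 ⟨by simp only; omega, by simp only; omega⟩, hd2⟩)
  have h2 := h1.trans (Nat.Ico_filter_coprime_le (a + 1) H hP.ne')
  have h3 : ((H / P : ℕ) : ℝ) ≤ H / P := Nat.cast_div_le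
  calc _ ≤ ((P.totient * (H / P + 1) : ℕ) : ℝ) := by exact_mod_cast h2
    _ = P.totient * ((H / P : ℕ) + 1 : ℝ) := by push_cast; ring
    _ ≤ _ := by gcongr

/-- The factorial moment of the number of primes in `(p, p + H]`, for a fixed choice of the
sieve parameters `W` and `z`. -/
theorem sum_descFactorial_le (W P N H n r : ℕ) (z : ℝ) (hP : 0 < P)
    (hPW : ∀ p : ℕ, p.Prime → p ∣ P → p ≤ W) (hWz : (W : ℝ) ≤ z) (hnr : n = r + 1)
    (hW : 2 * n ≤ W) (hCW : 2 * (n : ℝ) ^ 2 * 2 ^ n ≤ W) :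
    ∑ p ∈ Icc 1 N with p.Prime, ((#{d ∈ Icc 1 H | (p + d).Prime}).descFactorial r : ℝ) ≤
      z * H ^ r + P.totient * (N / P / selbergSum n (sievePrimes W z) z *
        (P.totient * (H / P + 1 : ℝ) + n * (2 * H * (2 * (2 * (n : ℝ) ^ 2 * 2 ^ n / W)))) ^ r
        + (∑ s ∈ sieveFamily (sievePrimes W z) z, (2 * n : ℝ) ^ #s) ^ 2 * H ^ r) := by
  have hn : 1 ≤ n := by omega
  have hz1 : 1 ≤ z := le_trans (by exact_mod_cast (by omega : 1 ≤ W)) hWz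
  set G : ℕ → ℝ := fun m => ((#{d ∈ Icc 1 H | (m + d).Prime}).descFactorial r : ℝ) with hG
  set B : ℝ := P.totient * (H / P + 1 : ℝ) + n * (2 * H * (2 * (2 * (n : ℝ) ^ 2 * 2 ^ n / W)))
    with hB
  set R : ℝ := (∑ s ∈ sieveFamily (sievePrimes W z) z, (2 * n : ℝ) ^ #s) ^ 2 with hR
  set J : ℝ := selbergSum n (sievePrimes W z) z with hJ
  have hJ0 : 0 ≤ J := selbergSum_nonneg (fun p hp => by
    have := (mem_sievePrimes.1 hp).1.1
    omega) z
  have hB0 : 0 ≤ B := by positivity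
  have hR0 : 0 ≤ R := by positivity
  have hGle : ∀ m, G m ≤ (H : ℝ) ^ r := by
    intro m
    have h1 : #{d ∈ Icc 1 H | (m + d).Prime} ≤ H :=
      (card_filter_le _ _).trans_eq (by simp)
    simp only [hG]
    exact_mod_cast (Nat.descFactorial_le_pow _ r).trans (Nat.pow_le_pow_left h1 r)
  have hsmall : ∑ p ∈ ((Icc 1 N).filter Nat.Prime).filter (fun p : ℕ => ¬ z < (p : ℝ)), G p ≤ z * H ^ r := by
    calc _ ≤ ∑ _p ∈ ((Icc 1 N).filter Nat.Prime).filter fun p : ℕ => ¬ z < (p : ℝ), (H : ℝ) ^ r :=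
          sum_le_sum fun p _ => hGle p
      _ = #(((Icc 1 N).filter Nat.Prime).filter fun p : ℕ => ¬ z < (p : ℝ)) * (H : ℝ) ^ r := by
          rw [sum_const, nsmul_eq_mul]
      _ ≤ _ := by
          refine mul_le_mul_of_nonneg_right ?_ (by positivity)
          have h1 : #(((Icc 1 N).filter Nat.Prime).filter fun p : ℕ => ¬ z < (p : ℝ)) ≤ #(Icc 1 ⌊z⌋₊) := by
            refine card_le_card fun p hp => ?_
            obtain ⟨hp1, hp2⟩ := mem_filter.1 hp
            exact mem_Icc.2 ⟨(mem_Icc.1 (mem_filter.1 hp1).1).1, Nat.le_floor (not_lt.1 hp2)⟩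
          rw [Nat.card_Icc, Nat.add_sub_cancel] at h1
          exact le_trans (by exact_mod_cast h1) (Nat.floor_le (by linarith))
  -- A prime exceeding `z ≥ W` is coprime to `P`.
  have hcop : ∀ q : ℕ, q.Prime → z < (q : ℝ) → P.Coprime q := by
    intro q hq hzq
    refine ((hq.coprime_iff_not_dvd).2 fun h => ?_).symm
    have h1 : (q : ℝ) ≤ W := by exact_mod_cast hPW q hq h
    linarith
  have hclass : ∀ a ∈ (range P).filter P.Coprime,
      ∑ p ∈ ((Icc 1 N).filter Nat.Prime).filter (fun p : ℕ => z < (p : ℝ) ∧ p % P = a), G p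
        ≤ N / P / J * B ^ r + R * H ^ r := by
    intro a ha
    set S := {d ∈ Icc 1 H | P.Coprime (a + d)} with hS
    set A := {m ∈ Ioc 0 N | m ≡ a [MOD P] ∧ z < (m : ℝ)} with hA
    have hScard := card_coprime_add_le P a H hP
    have hSH : #S ≤ H := (card_filter_le _ _).trans_eq (by simp)
    have haP := mem_range.1 (mem_filter.1 ha).1
    have h0S : (0 : ℕ) ∉ S := fun h => by simpa using (mem_Icc.1 (mem_filter.1 h).1).1
    have hG1 : ∀ m ∈ A, m.Prime → G m =
        tupleSum S (fun E => if ∀ x ∈ E, (m + x).Prime then 1 else 0) r {0} := by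
      intro m hm hmp
      obtain ⟨hm0, hma, hmz⟩ := mem_filter.1 hm
      rw [tupleSum_indicator S (fun x => (m + x).Prime), if_pos (by simpa using hmp)]
      simp only [hG]
      congr 3
      ext d
      simp only [mem_filter, mem_sdiff, mem_singleton, hS, mem_Icc]
      constructor
      · rintro ⟨hd, hmd⟩
        refine ⟨⟨⟨hd, ?_⟩, by omega⟩, hmd⟩
        have h1 := hcop _ hmd (by push_cast; linarith [Nat.cast_nonneg (α := ℝ) d])
        have h2 : m + d ≡ a + d [MOD P] := hma.add_right d
        rw [Nat.Coprime] at h1 ⊢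
        rw [Nat.gcd_comm, ← h2.gcd_eq, Nat.gcd_comm, h1]
      · rintro ⟨⟨⟨hd, -⟩, -⟩, hmd⟩
        exact ⟨hd, hmd⟩
    have hnn : ∀ m ∈ A,
        0 ≤ tupleSum S (fun E => if ∀ x ∈ E, (m + x).Prime then 1 else 0) r {0} := by
      intro m _
      rw [tupleSum_indicator S (fun x => (m + x).Prime)]
      split_ifs <;> positivity
    have hsum : ∑ p ∈ ((Icc 1 N).filter Nat.Prime).filter (fun p : ℕ => z < (p : ℝ) ∧ p % P = a), G p
        ≤ tupleSum S (fun E => ∑ m ∈ A, if ∀ x ∈ E, (m + x).Prime then 1 else 0) r {0} := by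
      rw [tupleSum_sum]
      have hsubA : ∀ p ∈ ((Icc 1 N).filter Nat.Prime).filter
          (fun p : ℕ => z < (p : ℝ) ∧ p % P = a), p ∈ A ∧ p.Prime := by
        intro p hp
        obtain ⟨hp1, hpz, hpa⟩ := mem_filter.1 hp
        obtain ⟨hp1, hpp⟩ := mem_filter.1 hp1
        refine ⟨mem_filter.2 ⟨mem_Ioc.2 (mem_Icc.1 hp1), ?_, hpz⟩, hpp⟩
        rw [Nat.ModEq, hpa, Nat.mod_eq_of_lt haP]
      rw [sum_congr rfl fun p hp => hG1 p (hsubA p hp).1 (hsubA p hp).2]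
      exact sum_le_sum_of_subset_of_nonneg (fun p hp => (hsubA p hp).1) fun m hm _ => hnn m hm
    have hU : S ⊆ range (H + 1) := fun d hd => by
      have := (mem_Icc.1 (mem_filter.1 hd).1).2
      exact mem_range.2 (by omega)
    have hmain := tupleSum_le S (range (H + 1)) hU
      (fun E => ∑ m ∈ A, if ∀ x ∈ E, (m + x).Prime then 1 else 0)
      (diffWeight n (sievePrimes W z)) (N / P / J) B R (by positivity) hB0 hR0 n
      (fun E hE hEn => by
        refine (sum_diffWeight_insert_le n W H z hn hW hCW S E (filter_subset _ _) hE
          hEn.le).trans (mul_le_mul_of_nonneg_right ?_ ?_)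
        · rw [hB]
          gcongr
        · refine prod_nonneg fun p hp => ?_
          have h1 := (mem_sievePrimes.1 (mem_filter.1 hp).1).1.1
          have h2 : (n : ℝ) < p := by exact_mod_cast (by omega : n < p)
          have h3 : 0 ≤ (n : ℝ) / (p - n) := div_nonneg (Nat.cast_nonneg n) (by linarith)
          linarith)
      (fun E hE hEn => by
        have h1 := card_prime_tuples_le W P N a n z hz1 hP hPW hn hW E hEn
        have h2 : (∑ m ∈ A, if ∀ x ∈ E, (m + x).Prime then (1 : ℝ) else 0)
            = #{m ∈ Ioc 0 N | m ≡ a [MOD P] ∧ z < m ∧ ∀ x ∈ E, (m + x).Prime} := by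
          rw [← sum_filter, sum_const, nsmul_eq_mul, mul_one, hA, filter_filter]
          simp only [and_assoc]
        rw [h2]
        refine h1.trans_eq ?_
        ring)
      r {0} (by simp) (by simp [hnr, add_comm])
    have hw0 : diffWeight n (sievePrimes W z) {0} = 1 := by
      rw [diffWeight, diffPrimes, filter_eq_empty_iff.2, prod_empty]
      rintro p - ⟨x, hx, y, hy, hxy, -⟩
      rw [mem_singleton] at hx hy
      exact hxy (hx.trans hy.symm)
    rw [hw0, mul_one] at hmain
    refine hsum.trans (hmain.trans (add_le_add_right ?_ _))
    refine mul_le_mul_of_nonneg_left ?_ hR0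
    gcongr
  have hlarge : ∑ p ∈ ((Icc 1 N).filter Nat.Prime).filter (fun p : ℕ => z < (p : ℝ)), G p
      ≤ P.totient * (N / P / J * B ^ r + R * H ^ r) := by
    rw [← sum_fiberwise_of_maps_to (g := fun p => p % P) (t := (range P).filter P.Coprime)]
    · calc _ = ∑ a ∈ (range P).filter P.Coprime,
            ∑ p ∈ ((Icc 1 N).filter Nat.Prime).filter (fun p : ℕ => z < (p : ℝ) ∧ p % P = a), G p := by
            refine sum_congr rfl fun a _ => ?_
            rw [filter_filter]
        _ ≤ ∑ _a ∈ (range P).filter P.Coprime, (N / P / J * B ^ r + R * H ^ r) :=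
            sum_le_sum hclass
        _ = _ := by rw [sum_const, nsmul_eq_mul, Nat.totient_eq_card_coprime]
    · intro p hp
      obtain ⟨hp1, hpz⟩ := mem_filter.1 hp
      refine mem_filter.2 ⟨mem_range.2 (Nat.mod_lt p hP), ?_⟩
      have h1 := hcop p (mem_filter.1 hp1).2 hpz
      rwa [Nat.Coprime, Nat.gcd_comm, ← Nat.gcd_rec]
  rw [← sum_filter_add_sum_filter_not _ (fun p : ℕ => z < (p : ℝ)), add_comm]
  exact add_le_add hsmall hlarge

/-! ### Choice of the sieve parameters -/

open Filter

theorem exists_one_add_pow_le (n : ℕ) (hn : 1 ≤ n) :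
    ∃ η : ℝ, 0 < η ∧ η ≤ 1 ∧ (1 + η) ^ n ≤ 6 / 5 := by
  have hn' : (1 : ℝ) ≤ n := by exact_mod_cast hn
  have h1 : (1 : ℝ) ≤ 5 * (n * 2 ^ n) := by
    have : (1 : ℝ) ≤ 2 ^ n := one_le_pow₀ (by norm_num)
    nlinarith
  have hle : 1 / (5 * ((n : ℝ) * 2 ^ n)) ≤ 1 := (div_le_one (by linarith)).2 h1
  refine ⟨1 / (5 * (n * 2 ^ n)), by positivity, hle, ?_⟩
  have h2 := one_add_pow_sub_one_le n (u := 1 / (5 * ((n : ℝ) * 2 ^ n))) (by positivity) hle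
  have h3 : (n : ℝ) * 2 ^ n * (1 / (5 * (n * 2 ^ n))) = 1 / 5 := by field_simp
  linarith

theorem pow_le_factorial_mul_choose (n j : ℕ) {η : ℝ} (hη : 0 < η) (hη1 : η ≤ 1)
    (hj : 2 * (n : ℝ) / η ≤ j) : (j : ℝ) ^ n ≤ (1 + η) ^ n * (n.factorial * j.choose n) := by
  have h1 : 2 * (n : ℝ) ≤ η * j := by
    rw [div_le_iff₀ hη] at hj
    linarith
  have hjn : n ≤ j := by
    have : (n : ℝ) ≤ j := by
      nlinarith [Nat.cast_nonneg (α := ℝ) n, Nat.cast_nonneg (α := ℝ) j]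
    exact_mod_cast this
  have h2 : ((j + 1 - n : ℕ) : ℝ) = j + 1 - n := by
    rw [Nat.cast_sub (by omega)]
    push_cast
    ring
  have h3 : ((j + 1 - n : ℕ) : ℝ) ^ n ≤ n.factorial * j.choose n := by
    exact_mod_cast (Nat.pow_sub_le_descFactorial j n).trans_eq
      (Nat.descFactorial_eq_factorial_mul_choose j n)
  have h4 : (j : ℝ) ≤ (1 + η) * ((j + 1 - n : ℕ) : ℝ) := by
    rw [h2]
    nlinarith [Nat.cast_nonneg (α := ℝ) n]
  calc (j : ℝ) ^ n ≤ ((1 + η) * ((j + 1 - n : ℕ) : ℝ)) ^ n :=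
        pow_le_pow_left₀ (Nat.cast_nonneg j) h4 n
    _ = (1 + η) ^ n * ((j + 1 - n : ℕ) : ℝ) ^ n := mul_pow _ _ _
    _ ≤ _ := mul_le_mul_of_nonneg_left h3 (by positivity)

/-- The modulus `P = ∏_{p ≤ W} p` can be chosen so that, for `H` large, the factor from
`sum_diffWeight_insert_le` exceeds the expected number `φ(P) / P * H` of admissible elements by at
most a factor `1 + η`. -/
theorem exists_modulus (n : ℕ) {η : ℝ} (hη : 0 < η) : ∃ W P : ℕ, ∃ H₀ : ℝ, 0 < P ∧ 2 * n ≤ W ∧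
    2 * (n : ℝ) ^ 2 * 2 ^ n ≤ W ∧ (∀ p : ℕ, p.Prime → (p ∣ P ↔ p ≤ W)) ∧
    ∀ H : ℕ, H₀ ≤ H →
      P.totient * (H / P + 1 : ℝ) + n * (2 * H * (2 * (2 * (n : ℝ) ^ 2 * 2 ^ n / W)))
        ≤ (1 + η) * ((P.totient : ℝ) / P * H) := by
  set C : ℝ := 2 * (n : ℝ) ^ 2 * 2 ^ n with hC
  have hC0 : 0 ≤ C := by positivity
  obtain ⟨K, hK⟩ := exists_nat_ge (max (max (n : ℝ) C) ((16 * n * C / η) ^ 2))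
  have hKn : (n : ℝ) ≤ K := (le_max_left _ _).trans ((le_max_left _ _).trans hK)
  have hKC : C ≤ K := (le_max_right _ _).trans ((le_max_left _ _).trans hK)
  have hKη : (16 * n * C / η) ^ 2 ≤ K := (le_max_right _ _).trans hK
  set W := 2 * K + 2 with hW
  set P := primorial W with hP
  have hPpos : 0 < P := primorial_pos W
  have hP0 : (0 : ℝ) < P := by exact_mod_cast hPpos
  refine ⟨W, P, 2 * P / η, hPpos, ?_, ?_, fun p hp => hp.dvd_primorial_iff, fun H hH => ?_⟩
  · have : n ≤ K := by exact_mod_cast hKn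
    omega
  · rw [hW]
    push_cast
    linarith [Nat.cast_nonneg (α := ℝ) K]
  · set ρ : ℝ := (P.totient : ℝ) / P with hρ
    have hρge : 1 / (2 * √(2 * K + 1)) ≤ ρ := totient_primorial_ge K
    have h1 : (P.totient : ℝ) * (H / P + 1) = ρ * H + ρ * P := by
      rw [hρ]
      field_simp
    have hρ0 : 0 ≤ ρ := by positivity
    have h2 : ρ * P ≤ η / 2 * (ρ * H) := by
      rw [div_le_iff₀ hη] at hH
      nlinarith [mul_le_mul_of_nonneg_left hH hρ0]
    have h3 : (n : ℝ) * (2 * (2 * (C / W))) ≤ η / 2 * ρ := by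
      have hs : 0 < √(2 * K + 1 : ℝ) := Real.sqrt_pos.2 (by positivity)
      have hsq : √(2 * K + 1 : ℝ) ^ 2 = 2 * K + 1 := Real.sq_sqrt (by positivity)
      have h4 : 16 * n * C / η ≤ √(2 * K + 1 : ℝ) := by
        refine Real.le_sqrt_of_sq_le ?_
        linarith [Nat.cast_nonneg (α := ℝ) K]
      have h5 : √(2 * K + 1 : ℝ) ^ 2 ≤ W := by
        rw [hsq, hW]
        push_cast
        linarith
      rw [div_le_iff₀ hη] at h4
      calc (n : ℝ) * (2 * (2 * (C / W))) ≤ n * (2 * (2 * (C / √(2 * K + 1 : ℝ) ^ 2))) := by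
            gcongr
        _ = (16 * n * C) / (4 * √(2 * K + 1 : ℝ) ^ 2) := by ring
        _ ≤ (√(2 * K + 1 : ℝ) * η) / (4 * √(2 * K + 1 : ℝ) ^ 2) := by gcongr
        _ = η / 2 * (1 / (2 * √(2 * K + 1))) := by field_simp; ring
        _ ≤ _ := by gcongr
    rw [h1]
    nlinarith [mul_le_mul_of_nonneg_right h3 (Nat.cast_nonneg (α := ℝ) H)]

theorem eventually_const_mul_log_pow_le (K : ℝ) (n : ℕ) {s : ℝ} (hs : 0 < s) :
    ∀ᶠ X : ℝ in atTop, K * Real.log X ^ n ≤ X ^ s := by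
  have h1 := (isLittleO_log_rpow_rpow_atTop (n : ℝ) hs).bound
    (show (0 : ℝ) < 1 / (|K| + 1) by positivity)
  filter_upwards [h1, eventually_ge_atTop 1] with X hX hX1
  have hl : 0 ≤ Real.log X := Real.log_nonneg hX1
  rw [Real.rpow_natCast, Real.norm_of_nonneg (by positivity),
    Real.norm_of_nonneg (by positivity), div_mul_eq_mul_div, one_mul,
    le_div_iff₀ (by positivity)] at hX
  have h2 : 0 ≤ Real.log X ^ n := by positivity
  nlinarith [mul_le_mul_of_nonneg_right (le_abs_self K) h2]

/-- Lower bound for Selberg's sum at `z = X ^ (1 / (2 (1 + η)))`, from `j` logarithmic blocks. One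
factor `(1 + η) ^ n` is lost to each of: the exponent of `z`, the incomplete first period in each
block, and the ratio of `j ^ n / n!` to `j.choose n`. -/
theorem totient_pow_mul_log_pow_le_selbergSum (n : ℕ) {W P j : ℕ} (hP : 0 < P) (hW : 2 * n ≤ W)
    (hPW : ∀ p : ℕ, p.Prime → (p ∣ P ↔ p ≤ W)) {η : ℝ} (hη : 0 < η) (hη1 : η ≤ 1)
    (hj : 2 * (n : ℝ) / η ≤ j) (hj0 : (0 : ℝ) < j) {X : ℝ} (hX0 : 0 < X) (hlog0 : 0 < Real.log X)
    (hXlog : j / (1 / (2 * (1 + η))) * ((1 + η) / η * Real.log (1 + 2 * P)) ≤ Real.log X) :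
    ((P.totient : ℝ) / P) ^ n * Real.log X ^ n ≤
      ((1 + η) ^ n) ^ 3 * (2 ^ n * n.factorial) *
        selbergSum n (sievePrimes W (X ^ (1 / (2 * (1 + η))))) (X ^ (1 / (2 * (1 + η)))) := by
  have hjpow := pow_le_factorial_mul_choose n j hη hη1 hj
  set ρ : ℝ := (P.totient : ℝ) / P
  have hρ0 : 0 ≤ ρ := by positivity
  set σ : ℝ := 1 / (2 * (1 + η)) with hσ
  have hσ0 : 0 < σ := by positivity
  set z : ℝ := X ^ σ with hz
  have hprime : ∀ p ∈ sievePrimes W z, p.Prime := fun p hp => (mem_sievePrimes.1 hp).2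
  set L : ℝ := σ * Real.log X / j with hL
  have hL0 : 0 < L := by positivity
  have hjL : (j : ℝ) * L = σ * Real.log X := by rw [hL]; field_simp
  have hexp : Real.exp (j * L) = z := by
    rw [hjL, hz, Real.rpow_def_of_pos hX0, mul_comm]
  have hL1 : (1 + η) / η * Real.log (1 + 2 * P) ≤ L := by
    rw [hL, le_div_iff₀ hj0]
    rw [div_mul_eq_mul_div, div_le_iff₀ hσ0] at hXlog
    linarith
  have hβ : ρ * (L / (1 + η)) ≤ ρ * (L - Real.log (1 + 2 * P)) := by
    refine mul_le_mul_of_nonneg_left ?_ hρ0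
    rw [div_mul_eq_mul_div, div_le_iff₀ hη] at hL1
    rw [div_le_iff₀ (by positivity)]
    linarith
  have h1 := choose_mul_pow_le_selbergSum P hP (sievePrimes W z) hprime hL0.le
    (by positivity : 0 ≤ ρ * (L / (1 + η))) hβ j (fun m hm hmz hcop p hp => by
      have hpp := Nat.prime_of_mem_primeFactors hp
      have hpm := Nat.dvd_of_mem_primeFactors hp
      rw [hexp] at hmz
      refine mem_sievePrimes.2 ⟨⟨?_, ?_⟩, hpp⟩
      · by_contra hle
        exact Nat.not_coprime_of_dvd_of_dvd hpp.one_lt ((hPW p hpp).2 (not_lt.1 hle)) hpm hcop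
      · exact (Nat.le_of_dvd (Nat.pos_of_ne_zero hm) hpm).trans (Nat.le_floor hmz))
    n (fun p hp => by have := (mem_sievePrimes.1 hp).1.1; omega) j le_rfl
  rw [hexp] at h1
  have h2 : ρ * Real.log X = 2 * (1 + η) ^ 2 * j * (ρ * (L / (1 + η))) := by
    rw [hL, hσ]
    field_simp
  have h3 : 0 ≤ (ρ * (L / (1 + η))) ^ n := by positivity
  calc ρ ^ n * Real.log X ^ n
      = 2 ^ n * ((1 + η) ^ n) ^ 2 * ((j : ℝ) ^ n * (ρ * (L / (1 + η))) ^ n) := by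
        rw [← mul_pow, h2]
        generalize ρ * (L / (1 + η)) = Y
        rw [mul_pow, mul_pow, mul_pow, pow_right_comm]
        ring
    _ ≤ 2 ^ n * ((1 + η) ^ n) ^ 2 * (((1 + η) ^ n * (n.factorial * j.choose n))
          * (ρ * (L / (1 + η))) ^ n) := by gcongr
    _ = ((1 + η) ^ n) ^ 3 * (2 ^ n * n.factorial)
          * (j.choose n * (ρ * (L / (1 + η))) ^ n) := by ring
    _ ≤ _ := mul_le_mul_of_nonneg_left h1 (by positivity)

set_option maxHeartbeats 1000000 in
/-- The factorial moments of the number of primes in `(p, p + H]`, averaged over primes `p ≤ X`.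
The sieve gives any constant above `1` in place of `3`. -/
theorem exists_sum_descFactorial_le (r : ℕ) : ∃ H₀ X₀ : ℝ, ∀ X : ℝ, X₀ ≤ X → ∀ H : ℕ, H₀ ≤ H →
    ∑ p ∈ Icc 1 ⌊X⌋₊ with p.Prime, ((#{d ∈ Icc 1 H | (p + d).Prime}).descFactorial r : ℝ) ≤
      3 * (2 ^ (r + 1) * (r + 1).factorial) * (X * H ^ r / Real.log X ^ (r + 1)) := by
  set n := r + 1 with hn
  obtain ⟨η, hη, hη1, hηn⟩ := exists_one_add_pow_le n (by omega)
  obtain ⟨W, P, H₀, hP, hW, hCW, hPW, hB⟩ := exists_modulus n hη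
  obtain ⟨C, hC, hrem⟩ := exists_sum_pow_card_le (2 * n : ℝ)
    (by have : (1 : ℝ) ≤ n := by exact_mod_cast (by omega : 1 ≤ n)
        linarith) (η / 2) (by positivity)
  obtain ⟨j, hj⟩ := exists_nat_ge (2 * (n : ℝ) / η)
  have hn1 : (1 : ℝ) ≤ n := by exact_mod_cast (by omega : 1 ≤ n)
  have hj0 : (0 : ℝ) < j := lt_of_lt_of_le (by positivity) hj
  have hP0 : (0 : ℝ) < P := by exact_mod_cast hP
  have hφ : (0 : ℝ) < P.totient := by exact_mod_cast Nat.totient_pos.2 hP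
  set ρ : ℝ := (P.totient : ℝ) / P with hρ
  have hρ0 : 0 < ρ := by positivity
  -- The level of distribution is `z ^ 2 = X ^ (1 / (1 + η))`.
  set σ : ℝ := 1 / (2 * (1 + η)) with hσ
  have hσ0 : 0 < σ := by positivity
  set τ : ℝ := (1 + η / 2) / (1 + η) with hτ
  have hτ1 : 0 < 1 - τ := by
    rw [hτ, sub_pos, div_lt_one (by positivity)]
    linarith
  obtain ⟨X₁, hX₁⟩ := eventually_atTop.1 ((eventually_const_mul_log_pow_le
    (1 + P.totient * C ^ 2) n hτ1).and ((eventually_ge_atTop (Real.exp 1)).and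
      ((Real.tendsto_log_atTop.eventually_ge_atTop
        (j / σ * ((1 + η) / η * Real.log (1 + 2 * P)))).and
        ((tendsto_rpow_atTop hσ0).eventually_ge_atTop (W : ℝ)))))
  refine ⟨H₀, X₁, fun X hX H hH => ?_⟩
  obtain ⟨hXrem, hXe, hXlog, hXW⟩ := hX₁ X hX
  have hX0 : 0 < X := (Real.exp_pos 1).trans_le hXe
  have hX1 : 1 ≤ X := le_trans (by linarith [Real.add_one_le_exp (1 : ℝ)]) hXe
  have hlog1 : 1 ≤ Real.log X := (Real.le_log_iff_exp_le hX0).2 hXe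
  have hlog0 : 0 < Real.log X := by linarith
  set z : ℝ := X ^ σ with hz
  have hz1 : 1 ≤ z := Real.one_le_rpow hX1 hσ0.le
  have hz0 : 0 < z := by linarith
  set J : ℝ := selbergSum n (sievePrimes W z) z with hJ
  have hmain := sum_descFactorial_le W P ⌊X⌋₊ H n r z hP (fun p hp h => (hPW p hp).1 h) hXW hn hW hCW
  refine hmain.trans ?_
  have hprime : ∀ p ∈ sievePrimes W z, p.Prime := fun p hp => (mem_sievePrimes.1 hp).2
  have hJge : ρ ^ n * Real.log X ^ n ≤ (6 / 5) ^ 3 * (2 ^ n * n.factorial) * J :=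
    (totient_pow_mul_log_pow_le_selbergSum n hP hW hPW hη hη1 hj hj0 hX0 hlog0 hXlog).trans
      (by gcongr; exact selbergSum_nonneg (fun p hp => by
        have := (mem_sievePrimes.1 hp).1.1
        omega) z)
  have hJ0 : 0 < J := by
    have h1 : 0 < ρ ^ n * Real.log X ^ n := by positivity
    by_contra hneg
    have h2 : (6 / 5 : ℝ) ^ 3 * (2 ^ n * n.factorial) * J ≤ 0 :=
      mul_nonpos_of_nonneg_of_nonpos (by positivity) (not_lt.1 hneg)
    linarith
  have hfloor : (⌊X⌋₊ : ℝ) ≤ X := Nat.floor_le hX0.le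
  have hmain1 : (P.totient : ℝ) * ((⌊X⌋₊ : ℝ) / P / J *
      (P.totient * (H / P + 1 : ℝ) + n * (2 * H * (2 * (2 * (n : ℝ) ^ 2 * 2 ^ n / W)))) ^ r)
      ≤ (6 / 5) ^ 4 * (2 ^ n * n.factorial) * (X * H ^ r / Real.log X ^ n) := by
    have hηr : (1 + η) ^ r ≤ 6 / 5 :=
      (pow_le_pow_right₀ (by linarith) (by omega)).trans hηn
    calc _ ≤ (P.totient : ℝ) * (X / P / J * ((1 + η) * (ρ * H)) ^ r) := by
          gcongr
          exact hB H hH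
      _ = X * H ^ r * (1 + η) ^ r * (ρ ^ n / J) := by
          have hφρ : (P.totient : ℝ) = ρ * P := (div_mul_cancel₀ _ hP0.ne').symm
          rw [mul_pow, mul_pow, hn, pow_succ, hφρ]
          field_simp
      _ ≤ X * H ^ r * (6 / 5) * ((6 / 5) ^ 3 * (2 ^ n * n.factorial) / Real.log X ^ n) := by
          gcongr ?_ * ?_
          · gcongr
          · rw [div_le_div_iff₀ hJ0 (by positivity)]
            exact hJge
      _ = _ := by ring
  have hmain2 : z * H ^ r + P.totient *
      ((∑ s ∈ sieveFamily (sievePrimes W z) z, (2 * n : ℝ) ^ #s) ^ 2 * H ^ r)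
      ≤ X * H ^ r / Real.log X ^ n := by
    have h1 := hrem (sievePrimes W z) hprime z hz1
    have h2 : (z ^ (1 + η / 2)) ^ 2 = X ^ τ := by
      rw [hz, ← Real.rpow_natCast, ← Real.rpow_mul hX0.le, ← Real.rpow_mul hX0.le]
      congr 1
      rw [hσ, hτ]
      push_cast
      field_simp
    have h3 : z ≤ X ^ τ := by
      rw [← h2]
      have h4 : z ≤ z ^ (1 + η / 2) := by
        conv_lhs => rw [← Real.rpow_one z]
        exact Real.rpow_le_rpow_of_exponent_le hz1 (by linarith)
      nlinarith
    have h5 : X ^ τ * ((1 + P.totient * C ^ 2) * Real.log X ^ n) ≤ X := by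
      calc _ ≤ X ^ τ * X ^ (1 - τ) := by gcongr
        _ = X := by rw [← Real.rpow_add hX0]; simp
    have h0 : 0 ≤ ∑ s ∈ sieveFamily (sievePrimes W z) z, (2 * n : ℝ) ^ #s :=
      sum_nonneg fun s _ => by positivity
    calc _ ≤ X ^ τ * H ^ r + P.totient * ((C * z ^ (1 + η / 2)) ^ 2 * H ^ r) := by gcongr
      _ = X ^ τ * (1 + P.totient * C ^ 2) * H ^ r := by rw [mul_pow, h2]; ring
      _ ≤ _ := by
          rw [le_div_iff₀ (by positivity)]
          calc _ = X ^ τ * ((1 + P.totient * C ^ 2) * Real.log X ^ n) * H ^ r := by ring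
            _ ≤ X * H ^ r := by gcongr
  have hQ : 0 ≤ X * (H : ℝ) ^ r / Real.log X ^ n := by positivity
  have hfac : (1 : ℝ) ≤ n.factorial := by exact_mod_cast Nat.factorial_pos n
  have h2n : (2 : ℝ) ≤ 2 ^ n := by
    rw [hn, pow_succ]
    linarith [one_le_pow₀ (n := r) (one_le_two : (1 : ℝ) ≤ 2)]
  have hK : (2 : ℝ) ≤ 2 ^ n * n.factorial := by nlinarith
  rw [mul_add]
  have hfin : (1 + (6 / 5) ^ 4 * (2 ^ n * n.factorial)) * (X * (H : ℝ) ^ r / Real.log X ^ n)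
      ≤ 3 * (2 ^ n * n.factorial) * (X * (H : ℝ) ^ r / Real.log X ^ n) := by
    refine mul_le_mul_of_nonneg_right ?_ hQ
    linarith
  linarith

/-! ### From factorial moments of prime counts to moments of `ψ` -/

theorem pow_eq_sum_stirlingSecond_mul_descFactorial (N k : ℕ) :
    N ^ k = ∑ r ∈ range (k + 1), Nat.stirlingSecond k r * N.descFactorial r := by
  induction k with
  | zero => simp
  | succ k ih =>
    have h1 : ∀ r, N * N.descFactorial r = N.descFactorial (r + 1) + r * N.descFactorial r := by
      intro r
      rcases le_or_gt r N with h | h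
      · rw [Nat.descFactorial_succ, ← add_mul, Nat.sub_add_cancel h]
      · simp [Nat.descFactorial_of_lt h]
    have h2 : ∑ r ∈ range (k + 1), Nat.stirlingSecond k r * (r * N.descFactorial r)
        = ∑ r ∈ range (k + 1), (r + 1) * Nat.stirlingSecond k (r + 1) * N.descFactorial (r + 1) := by
      have h3 := sum_range_succ' (fun r => Nat.stirlingSecond k r * (r * N.descFactorial r)) (k + 1)
      rw [sum_range_succ, Nat.stirlingSecond_eq_zero_of_lt k.lt_succ_self] at h3
      simp only [zero_mul, mul_zero, add_zero] at h3
      rw [h3]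
      exact sum_congr rfl fun r _ => by ring
    rw [sum_range_succ', Nat.stirlingSecond_succ_zero, zero_mul, add_zero, pow_succ, ih, sum_mul]
    calc _ = ∑ r ∈ range (k + 1), (Nat.stirlingSecond k r * N.descFactorial (r + 1)
            + Nat.stirlingSecond k r * (r * N.descFactorial r)) := by
          refine sum_congr rfl fun r _ => ?_
          rw [← mul_add, ← h1]
          ring
      _ = _ := by
          rw [sum_add_distrib, h2, ← sum_add_distrib]
          refine sum_congr rfl fun r _ => ?_
          rw [Nat.stirlingSecond_succ_succ]
          ring

theorem add_pow_succ_le {a b : ℝ} (ha : 0 ≤ a) (hb : 0 ≤ b) (k : ℕ) :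
    (a + b) ^ (k + 1) ≤ a ^ (k + 1) + (k + 1) * b * (a + b) ^ k := by
  induction k with
  | zero => simp
  | succ k ih =>
    have h1 : a ^ (k + 1) ≤ (a + b) ^ (k + 1) := pow_le_pow_left₀ ha (by linarith) _
    calc (a + b) ^ (k + 1 + 1) = (a + b) * (a + b) ^ (k + 1) := by ring
      _ ≤ (a + b) * (a ^ (k + 1) + (k + 1) * b * (a + b) ^ k) :=
          mul_le_mul_of_nonneg_left ih (by linarith)
      _ = a ^ (k + 1 + 1) + b * a ^ (k + 1) + (k + 1) * b * (a + b) ^ (k + 1) := by ring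
      _ ≤ _ := by
          push_cast
          nlinarith [mul_le_mul_of_nonneg_left h1 hb]

theorem floor_natCast_add {h : ℝ} (hh : 0 ≤ h) (m : ℕ) : ⌊(m : ℝ) + h⌋₊ = m + ⌊h⌋₊ := by
  rw [add_comm, Nat.floor_add_natCast hh, add_comm]

theorem theta_sub_le {m : ℕ} {h Y : ℝ} (hh : 0 ≤ h) (hY : (m : ℝ) + h ≤ Y) :
    Chebyshev.theta (m + h) - Chebyshev.theta m
      ≤ #{d ∈ Icc 1 ⌊h⌋₊ | (m + d).Prime} * Real.log Y := by
  have h1 : Chebyshev.theta (m + h) - Chebyshev.theta m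
      = ∑ q ∈ Ioc m (m + ⌊h⌋₊) with q.Prime, Real.log q := by
    rw [Chebyshev.theta, Chebyshev.theta, floor_natCast_add hh, Nat.floor_natCast, sum_filter,
      sum_filter, sum_filter,
      ← sum_Ioc_consecutive _ (Nat.zero_le m) (Nat.le_add_right m ⌊h⌋₊), add_sub_cancel_left]
  have h2 : #{q ∈ Ioc m (m + ⌊h⌋₊) | q.Prime} ≤ #{d ∈ Icc 1 ⌊h⌋₊ | (m + d).Prime} := by
    refine card_le_card_of_injOn (· - m) ?_ ?_
    · intro q hq
      obtain ⟨hq1, hq2⟩ := mem_filter.1 (mem_coe.1 hq)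
      rw [mem_Ioc] at hq1
      refine mem_coe.2 (mem_filter.2 ⟨mem_Icc.2 ⟨?_, ?_⟩, ?_⟩)
      · simp only; omega
      · simp only; omega
      · simpa only [Nat.add_sub_cancel' hq1.1.le] using hq2
    · intro q hq q' hq' e
      have hq1 := mem_Ioc.1 (mem_filter.1 (mem_coe.1 hq)).1
      have hq1' := mem_Ioc.1 (mem_filter.1 (mem_coe.1 hq')).1
      simp only at e
      omega
  have h4 : (⌊h⌋₊ : ℝ) ≤ h := Nat.floor_le hh
  rw [h1]
  calc _ ≤ ∑ _q ∈ Ioc m (m + ⌊h⌋₊) with _q.Prime, Real.log Y := by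
        refine sum_le_sum fun q hq => ?_
        obtain ⟨hq1, hq2⟩ := mem_filter.1 hq
        have h3 : (q : ℝ) ≤ m + ⌊h⌋₊ := by exact_mod_cast (mem_Ioc.1 hq1).2
        exact Real.log_le_log (by exact_mod_cast hq2.pos) (by linarith)
    _ = #{q ∈ Ioc m (m + ⌊h⌋₊) | q.Prime} * Real.log Y := by rw [sum_const, nsmul_eq_mul]
    _ ≤ _ := by
        rcases Nat.eq_zero_or_pos #{q ∈ Ioc m (m + ⌊h⌋₊) | q.Prime} with h0 | h0
        · rw [h0, Nat.cast_zero, zero_mul]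
          rcases Nat.eq_zero_or_pos m with hm | hm
          · rcases Nat.eq_zero_or_pos ⌊h⌋₊ with hf | hf
            · simp [hf]
            · refine mul_nonneg (Nat.cast_nonneg _) (Real.log_nonneg ?_)
              have h5 : (1 : ℝ) ≤ ⌊h⌋₊ := by exact_mod_cast hf
              linarith [Nat.cast_nonneg (α := ℝ) m]
          · refine mul_nonneg (Nat.cast_nonneg _) (Real.log_nonneg ?_)
            have h5 : (1 : ℝ) ≤ m := by exact_mod_cast hm
            linarith
        · obtain ⟨q, hq⟩ := card_pos.1 h0
          obtain ⟨hq1, hq2⟩ := mem_filter.1 hq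
          have h3 : (q : ℝ) ≤ m + ⌊h⌋₊ := by exact_mod_cast (mem_Ioc.1 hq1).2
          have h5 : (1 : ℝ) ≤ q := by exact_mod_cast hq2.one_le
          exact mul_le_mul_of_nonneg_right (by exact_mod_cast h2) (Real.log_nonneg (by linarith))

theorem psi_sub_le {m : ℕ} {h Y : ℝ} (hh : 0 ≤ h) (hY : (m : ℝ) + h ≤ Y) :
    Chebyshev.psi (m + h) - Chebyshev.psi m ≤ ⌊h⌋₊ * Real.log Y := by
  have h1 : Chebyshev.psi (m + h) - Chebyshev.psi m
      = ∑ q ∈ Ioc m (m + ⌊h⌋₊), ArithmeticFunction.vonMangoldt q := by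
    rw [Chebyshev.psi, Chebyshev.psi, floor_natCast_add hh, Nat.floor_natCast,
      ← sum_Ioc_consecutive _ (Nat.zero_le m) (Nat.le_add_right m ⌊h⌋₊), add_sub_cancel_left]
  have h4 : (⌊h⌋₊ : ℝ) ≤ h := Nat.floor_le hh
  rw [h1]
  calc _ ≤ ∑ _q ∈ Ioc m (m + ⌊h⌋₊), Real.log Y := by
        refine sum_le_sum fun q hq => ?_
        have hq1 := mem_Ioc.1 hq
        have h3 : (q : ℝ) ≤ m + ⌊h⌋₊ := by exact_mod_cast hq1.2
        refine ArithmeticFunction.vonMangoldt_le_log.trans ?_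
        exact Real.log_le_log (by exact_mod_cast (Nat.zero_le m).trans_lt hq1.1) (by linarith)
    _ = _ := by rw [sum_const, nsmul_eq_mul]; simp

theorem psi_sub_theta_mono : Monotone fun x => Chebyshev.psi x - Chebyshev.theta x := by
  intro x y hxy
  simp only
  rw [Chebyshev.psi_sub_theta_eq_sum_not_prime, Chebyshev.psi_sub_theta_eq_sum_not_prime]
  refine sum_le_sum_of_subset_of_nonneg ?_ fun _ _ _ => ArithmeticFunction.vonMangoldt_nonneg
  exact filter_subset_filter _ (Ioc_subset_Ioc_right (Nat.floor_le_floor hxy))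

/-- Telescoping bound for the total increment of a monotone function over windows of length `H`. -/
theorem sum_Icc_shift_sub_le (F : ℕ → ℝ) (hF : Monotone F) (hF0 : ∀ m, 0 ≤ F m) (N H : ℕ) :
    ∑ m ∈ Icc 1 N, (F (m + H) - F m) ≤ H * F (N + H) := by
  induction H with
  | zero => simp
  | succ H ih =>
    have h1 : ∑ m ∈ Icc 1 N, (F (m + (H + 1)) - F (m + H)) = F (N + (H + 1)) - F (1 + H) := by
      clear ih
      induction N with
      | zero => simp [add_comm]
      | succ N ih =>
        rw [sum_Icc_succ_top (by omega), ih, show N + 1 + H = N + (H + 1) by ring]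
        ring
    have h2 : ∑ m ∈ Icc 1 N, (F (m + (H + 1)) - F m)
        = ∑ m ∈ Icc 1 N, (F (m + (H + 1)) - F (m + H)) + ∑ m ∈ Icc 1 N, (F (m + H) - F m) := by
      rw [← sum_add_distrib]
      exact sum_congr rfl fun m _ => by ring
    rw [h2, h1]
    have h3 : (H : ℝ) * F (N + H) ≤ H * F (N + (H + 1)) :=
      mul_le_mul_of_nonneg_left (hF (by omega)) (Nat.cast_nonneg H)
    push_cast
    linarith [hF0 (1 + H)]

/-- The prime moment in terms of factorial moments of prime counts; the last term bounds the
contribution of proper prime powers. -/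
theorem primeMoment_succ_le (k : ℕ) {X h : ℝ} (hX : 1 ≤ X) (hh : 0 ≤ h) (hhX : h ≤ X) :
    primeMoment (k + 1) X h ≤
      Real.log (2 * X) ^ (k + 1) * ∑ i ∈ range (k + 1), (Nat.stirlingSecond (k + 1) (i + 1) : ℝ) *
        ∑ p ∈ Icc 1 ⌊X⌋₊ with p.Prime,
          ((#{d ∈ Icc 1 ⌊h⌋₊ | (p + d).Prime}).descFactorial (i + 1) : ℝ)
      + (k + 1) * (h * Real.log (2 * X)) ^ (k + 1) * (2 * √(2 * X)) := by
  set ℓ := Real.log (2 * X) with hℓ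
  have hℓ0 : 0 ≤ ℓ := Real.log_nonneg (by linarith)
  set H := ⌊h⌋₊ with hH
  have hHh : (H : ℝ) ≤ h := Nat.floor_le hh
  set E : ℝ → ℝ := fun x => Chebyshev.psi x - Chebyshev.theta x with hE
  set C : ℕ → ℕ := fun p => #{d ∈ Icc 1 H | (p + d).Prime} with hC
  have hNX : (⌊X⌋₊ : ℝ) ≤ X := Nat.floor_le (by linarith)
  have hterm : ∀ p ∈ (Icc 1 ⌊X⌋₊).filter Nat.Prime,
      (Chebyshev.psi ((p : ℝ) + h) - Chebyshev.psi (p : ℝ)) ^ (k + 1)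
        ≤ ℓ ^ (k + 1) * (C p : ℝ) ^ (k + 1)
          + (k + 1) * (h * ℓ) ^ k * (E ((p + H : ℕ) : ℝ) - E (p : ℝ)) := by
    intro p hp
    have hpX : (p : ℝ) ≤ X :=
      le_trans (by exact_mod_cast (mem_Icc.1 (mem_filter.1 hp).1).2) hNX
    have hY : (p : ℝ) + h ≤ 2 * X := by linarith
    have hEfl : E ((p : ℝ) + h) = E ((p + H : ℕ) : ℝ) := by
      simp only [hE]
      rw [Chebyshev.psi_eq_psi_coe_floor, Chebyshev.theta_eq_theta_coe_floor,
        floor_natCast_add hh]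
    set a := Chebyshev.theta ((p : ℝ) + h) - Chebyshev.theta p with ha
    set b := E ((p + H : ℕ) : ℝ) - E (p : ℝ) with hb
    have hab : Chebyshev.psi ((p : ℝ) + h) - Chebyshev.psi (p : ℝ) = a + b := by
      rw [hb, ← hEfl]
      simp only [hE, ha]
      ring
    have ha0 : 0 ≤ a := sub_nonneg.2 (Chebyshev.theta_mono (by linarith))
    have hb0 : 0 ≤ b := sub_nonneg.2 (psi_sub_theta_mono (by push_cast; linarith))
    have ha1 : a ≤ C p * ℓ := theta_sub_le hh hY
    have hab1 : a + b ≤ h * ℓ := by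
      rw [← hab]
      exact (psi_sub_le hh hY).trans (mul_le_mul_of_nonneg_right hHh hℓ0)
    rw [hab]
    calc (a + b) ^ (k + 1) ≤ a ^ (k + 1) + (k + 1) * b * (a + b) ^ k := add_pow_succ_le ha0 hb0 k
      _ ≤ (C p * ℓ) ^ (k + 1) + (k + 1) * b * (h * ℓ) ^ k := by gcongr
      _ = _ := by ring
  have hpow : ∑ p ∈ Icc 1 ⌊X⌋₊ with p.Prime, (C p : ℝ) ^ (k + 1)
      = ∑ i ∈ range (k + 1), (Nat.stirlingSecond (k + 1) (i + 1) : ℝ) *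
        ∑ p ∈ Icc 1 ⌊X⌋₊ with p.Prime, ((C p).descFactorial (i + 1) : ℝ) := by
    simp_rw [mul_sum]
    rw [sum_comm]
    refine sum_congr rfl fun p _ => ?_
    have h1 := pow_eq_sum_stirlingSecond_mul_descFactorial (C p) (k + 1)
    rw [sum_range_succ', Nat.stirlingSecond_succ_zero, zero_mul, add_zero] at h1
    exact_mod_cast h1
  have hEsum : ∑ p ∈ Icc 1 ⌊X⌋₊ with p.Prime, (E ((p + H : ℕ) : ℝ) - E (p : ℝ))
      ≤ h * (2 * √(2 * X) * ℓ) := by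
    have hmono : Monotone fun m : ℕ => E (m : ℝ) := fun m m' hm =>
      psi_sub_theta_mono (by exact_mod_cast hm)
    have hE0 : ∀ x, 0 ≤ E x := fun x => sub_nonneg.2 (Chebyshev.theta_le_psi x)
    calc _ ≤ ∑ p ∈ Icc 1 ⌊X⌋₊, (E ((p + H : ℕ) : ℝ) - E (p : ℝ)) :=
          sum_le_sum_of_subset_of_nonneg (filter_subset _ _) fun p _ _ =>
            sub_nonneg.2 (hmono (by omega))
      _ ≤ H * E ((⌊X⌋₊ + H : ℕ) : ℝ) :=
          sum_Icc_shift_sub_le (fun m : ℕ => E (m : ℝ)) hmono (fun m => hE0 m) _ _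
      _ ≤ h * E (2 * X) := by
          refine mul_le_mul hHh (psi_sub_theta_mono ?_) (hE0 _) hh
          push_cast
          linarith
      _ ≤ _ := mul_le_mul_of_nonneg_left (Chebyshev.psi_sub_theta_le (by linarith)) hh
  calc primeMoment (k + 1) X h ≤ _ := sum_le_sum hterm
    _ = ℓ ^ (k + 1) * ∑ p ∈ Icc 1 ⌊X⌋₊ with p.Prime, (C p : ℝ) ^ (k + 1)
        + (k + 1) * (h * ℓ) ^ k *
          ∑ p ∈ Icc 1 ⌊X⌋₊ with p.Prime, (E ((p + H : ℕ) : ℝ) - E (p : ℝ)) := by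
        rw [sum_add_distrib, ← mul_sum, ← mul_sum]
    _ ≤ _ := by
        rw [hpow]
        refine add_le_add_right ?_ _
        refine (mul_le_mul_of_nonneg_left hEsum (by positivity)).trans_eq ?_
        ring

/-- Since `ω ^ m ≥ 4 (ω - 1)` for `m ≥ 2`, the polynomial of degree `k + 1` in the moment bound
exceeds the one that the sieve produces by a factor at least `4 (ω - 1)`, term by term. -/
theorem four_mul_le_momentPoly (k : ℕ) {ω y : ℝ} (hω : 1 < ω) (hy : 0 ≤ y) :
    4 * (ω - 1) * ∑ i ∈ range k, (Nat.stirlingSecond k (i + 1) : ℝ) *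
      (2 ^ (i + 2) * (i + 2).factorial * y ^ (i + 2)) ≤ momentPoly (k + 1) (ω * y) := by
  have e : Icc 1 (k + 1) = Ico 1 (k + 2) := by
    ext x
    simp only [mem_Icc, mem_Ico]
    omega
  have hω0 : 0 < ω := by linarith
  rw [momentPoly, e, sum_Ico_eq_sum_range, show k + 2 - 1 = k + 1 by omega, sum_range_succ']
  refine le_trans ?_ (le_add_of_nonneg_right (by positivity))
  rw [mul_sum]
  refine sum_le_sum fun i _ => ?_
  rw [show 1 + (i + 1) = i + 1 + 1 by ring]
  have h1 : (Nat.stirlingSecond k (i + 1) : ℝ) ≤ Nat.stirlingSecond (k + 1) (i + 1 + 1) := by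
    rw [Nat.stirlingSecond_succ_succ]
    push_cast
    have : (0 : ℝ) ≤ ((i : ℝ) + 1 + 1) * Nat.stirlingSecond k (i + 1 + 1) := by positivity
    linarith
  have h2 : 4 * (ω - 1) ≤ ω ^ (i + 2) := by
    calc 4 * (ω - 1) ≤ ω ^ 2 := by nlinarith [sq_nonneg (ω - 2)]
      _ ≤ _ := pow_le_pow_right₀ hω.le (by omega)
  calc _ ≤ ω ^ (i + 2) * ((Nat.stirlingSecond (k + 1) (i + 1 + 1) : ℝ) *
        (2 ^ (i + 2) * (i + 2).factorial * y ^ (i + 2))) := by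
        refine mul_le_mul h2 (by gcongr) (by positivity) (by positivity)
    _ = _ := by rw [mul_pow]; ring

/-- The moment bound without `ω`. The sieve loses a factor `2 ^ (r + 1) (r + 1)!` in the term of
degree `r + 1`, up to `1 + o(1)`, which the constant `4` more than covers. -/
theorem exists_primeMoment_le (k : ℕ) (hk : 1 ≤ k) : ∃ h₀ X₀ : ℝ, ∀ X : ℝ, X₀ ≤ X →
    ∀ h : ℝ, h₀ ≤ h → h ≤ X →
      primeMoment k X h ≤ 4 * (X / h) * (∑ i ∈ range k, (Nat.stirlingSecond k (i + 1) : ℝ) *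
        (2 ^ (i + 2) * (i + 2).factorial * (h / Real.log X) ^ (i + 2))) * Real.log X ^ k := by
  obtain ⟨k, rfl⟩ : ∃ j, k = j + 1 := ⟨k - 1, by omega⟩
  choose H₀ X₀ hfact using fun i : ℕ => exists_sum_descFactorial_le (i + 1)
  obtain ⟨MH, hMH⟩ := ((range (k + 1)).image H₀).exists_le
  obtain ⟨MX, hMX⟩ := ((range (k + 1)).image X₀).exists_le
  obtain ⟨η, hη, hη1, hηk⟩ := exists_one_add_pow_le (k + 1) (by omega)
  obtain ⟨X₁, hX₁⟩ := eventually_atTop.1 (((eventually_ge_atTop (max MX (Real.exp 1))).and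
    (Real.tendsto_log_atTop.eventually_ge_atTop (Real.log 2 / η))).and
      (eventually_const_mul_log_pow_le (9 * (k + 1)) (k + 2) (show (0 : ℝ) < 1 / 2 by norm_num)))
  refine ⟨max 1 (MH + 1), X₁, fun X hX h hh hhX => ?_⟩
  obtain ⟨⟨hXM, hXlog⟩, hXsqrt⟩ := hX₁ X hX
  have hXe : Real.exp 1 ≤ X := (le_max_right _ _).trans hXM
  have hX1 : 1 ≤ X := le_trans (by linarith [Real.add_one_le_exp (1 : ℝ)]) hXe
  have hX0 : 0 < X := by linarith
  have hl1 : 1 ≤ Real.log X := (Real.le_log_iff_exp_le hX0).2 hXe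
  have hl0 : 0 < Real.log X := by linarith
  have hh1 : 1 ≤ h := (le_max_left _ _).trans hh
  have hh0 : 0 < h := by linarith
  have hHM : MH ≤ ⌊h⌋₊ := by
    have h1 : MH + 1 ≤ h := (le_max_right _ _).trans hh
    linarith [Nat.lt_floor_add_one h]
  have hHh : (⌊h⌋₊ : ℝ) ≤ h := Nat.floor_le hh0.le
  set l := Real.log X with hl
  have hℓ : Real.log (2 * X) ≤ (1 + η) * l := by
    rw [Real.log_mul (by norm_num) hX0.ne']
    rw [div_le_iff₀ hη] at hXlog
    linarith
  have hℓ0 : 0 ≤ Real.log (2 * X) := Real.log_nonneg (by linarith)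
  have hℓk : Real.log (2 * X) ^ (k + 1) ≤ 6 / 5 * l ^ (k + 1) := by
    calc _ ≤ ((1 + η) * l) ^ (k + 1) := pow_le_pow_left₀ hℓ0 hℓ _
      _ = (1 + η) ^ (k + 1) * l ^ (k + 1) := mul_pow _ _ _
      _ ≤ _ := by gcongr
  set S : ℝ := ∑ i ∈ range (k + 1), (Nat.stirlingSecond (k + 1) (i + 1) : ℝ) *
    (2 ^ (i + 2) * (i + 2).factorial * (h / l) ^ (i + 2)) with hS
  -- The sieve bound for the factorial moments.
  have hmain : ∑ i ∈ range (k + 1), (Nat.stirlingSecond (k + 1) (i + 1) : ℝ) *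
        ∑ p ∈ Icc 1 ⌊X⌋₊ with p.Prime,
          ((#{d ∈ Icc 1 ⌊h⌋₊ | (p + d).Prime}).descFactorial (i + 1) : ℝ) ≤ 3 * (X / h) * S := by
    rw [hS, mul_sum]
    refine sum_le_sum fun i hi => ?_
    have h1 := hfact i X ((hMX _ (mem_image_of_mem _ hi)).trans ((le_max_left _ _).trans hXM))
      ⌊h⌋₊ ((hMH _ (mem_image_of_mem _ hi)).trans hHM)
    calc _ ≤ (Nat.stirlingSecond (k + 1) (i + 1) : ℝ) * (3 * (2 ^ (i + 1 + 1) *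
          (i + 1 + 1).factorial) * (X * h ^ (i + 1) / l ^ (i + 1 + 1))) := by
          refine mul_le_mul_of_nonneg_left (h1.trans ?_) (Nat.cast_nonneg _)
          gcongr
      _ = _ := by
          rw [div_pow, pow_succ h (i + 1)]
          field_simp
  -- The proper prime powers, absorbed by the term of highest degree.
  have herr : ((k : ℝ) + 1) * (h * Real.log (2 * X)) ^ (k + 1) * (2 * √(2 * X))
      ≤ 2 / 5 * (X / h * S) * l ^ (k + 1) := by
    have hS1 : (h / l) ^ (k + 2) ≤ S := by
      have h1 : (Nat.stirlingSecond (k + 1) (k + 1) : ℝ) *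
          (2 ^ (k + 2) * (k + 2).factorial * (h / l) ^ (k + 2)) ≤ S :=
        single_le_sum (f := fun i => (Nat.stirlingSecond (k + 1) (i + 1) : ℝ) *
          (2 ^ (i + 2) * (i + 2).factorial * (h / l) ^ (i + 2)))
          (fun i _ => by positivity) (self_mem_range_succ k)
      rw [Nat.stirlingSecond_self, Nat.cast_one, one_mul] at h1
      refine le_trans (le_mul_of_one_le_left (by positivity) ?_) h1
      have h2 : (1 : ℝ) ≤ 2 ^ (k + 2) := one_le_pow₀ (by norm_num)
      have h3 : (1 : ℝ) ≤ (k + 2).factorial := by exact_mod_cast Nat.factorial_pos (k + 2)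
      nlinarith
    have hsq : √(2 * X) ≤ 3 / 2 * √X := by
      rw [Real.sqrt_mul (by norm_num)]
      refine mul_le_mul_of_nonneg_right ?_ (Real.sqrt_nonneg X)
      rw [Real.sqrt_le_left (by norm_num)]
      norm_num
    have hXs : √X * √X = X := Real.mul_self_sqrt hX0.le
    rw [← Real.sqrt_eq_rpow] at hXsqrt
    have hs0 : 0 < √X := Real.sqrt_pos.2 hX0
    calc ((k : ℝ) + 1) * (h * Real.log (2 * X)) ^ (k + 1) * (2 * √(2 * X))
        = ((k : ℝ) + 1) * (h ^ (k + 1) * Real.log (2 * X) ^ (k + 1)) * (2 * √(2 * X)) := by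
          rw [mul_pow]
      _ ≤ ((k : ℝ) + 1) * (h ^ (k + 1) * (6 / 5 * l ^ (k + 1))) * (2 * (3 / 2 * √X)) := by gcongr
      _ = 2 / 5 * h ^ (k + 1) * √X * (9 * (k + 1) * l ^ (k + 2)) / l := by
          rw [pow_succ l (k + 1)]
          field_simp
          ring
      _ ≤ 2 / 5 * h ^ (k + 1) * √X * √X / l := by gcongr
      _ = 2 / 5 * (X / h * (h / l) ^ (k + 2)) * l ^ (k + 1) := by
          rw [mul_assoc _ (√X), hXs, div_pow, pow_succ h (k + 1), pow_succ l (k + 1)]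
          field_simp
      _ ≤ _ := by gcongr
  have hS0 : 0 ≤ S := sum_nonneg fun i _ => by positivity
  calc primeMoment (k + 1) X h ≤ _ := primeMoment_succ_le k hX1 hh0.le hhX
    _ ≤ 6 / 5 * l ^ (k + 1) * (3 * (X / h) * S) + 2 / 5 * (X / h * S) * l ^ (k + 1) := by
        refine add_le_add ?_ herr
        refine mul_le_mul hℓk hmain ?_ (by positivity)
        exact sum_nonneg fun i _ => mul_nonneg (Nat.cast_nonneg _)
          (sum_nonneg fun p _ => Nat.cast_nonneg _)
    _ = _ := by ring

end PrimeMoment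

theorem mainTheorem2 (k : ℕ) (hk : 2 ≤ k) (ω : ℝ) (hω : 1 < ω)
    (ε : ℝ) (hε : 0 < ε) (δ : ℝ) (hδ : 0 < δ)
    (f : ℝ → ℝ) (hf : Filter.Tendsto f Filter.atTop Filter.atTop) :
    ∃ X₀ : ℝ, ∀ X : ℝ, X₀ ≤ X → ∀ h : ℝ, f X ≤ h → h ≤ X ^ (1 - δ) →
      primeMoment k X h ≤
        (momentPoly (k + 1) (ω * h / Real.log X) + ε) *
          (X / (h * (ω - 1))) * Real.log X ^ k := by
  obtain ⟨h₀, X₀, hmain⟩ := PrimeMoment.exists_primeMoment_le k (by omega)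
  obtain ⟨X₁, hX₁⟩ := Filter.eventually_atTop.1
    ((hf.eventually_ge_atTop (max 1 h₀)).and (Filter.eventually_ge_atTop (max X₀ (Real.exp 1))))
  refine ⟨X₁, fun X hX h hfh hhX => ?_⟩
  obtain ⟨hfX, hXM⟩ := hX₁ X hX
  have hXe : Real.exp 1 ≤ X := (le_max_right _ _).trans hXM
  have hX1 : 1 ≤ X := le_trans (by linarith [Real.add_one_le_exp (1 : ℝ)]) hXe
  have hX0 : 0 < X := by linarith
  have hl0 : 0 < Real.log X := by linarith [(Real.le_log_iff_exp_le hX0).2 hXe]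
  have hh1 : 1 ≤ h := ((le_max_left _ _).trans hfX).trans hfh
  have hh0 : 0 < h := by linarith
  have hω0 : 0 < ω - 1 := by linarith
  have hhX' : h ≤ X := by
    refine hhX.trans ?_
    conv_rhs => rw [← Real.rpow_one X]
    exact Real.rpow_le_rpow_of_exponent_le hX1 (by linarith)
  have hpoly := PrimeMoment.four_mul_le_momentPoly k hω (show 0 ≤ h / Real.log X by positivity)
  rw [← mul_div_assoc] at hpoly
  refine (hmain X ((le_max_left _ _).trans hXM) h (((le_max_right _ _).trans hfX).trans hfh)
    hhX').trans ?_
  set S := ∑ i ∈ Finset.range k, (Nat.stirlingSecond k (i + 1) : ℝ) *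
    (2 ^ (i + 2) * (i + 2).factorial * (h / Real.log X) ^ (i + 2))
  calc 4 * (X / h) * S * Real.log X ^ k
      = (4 * (ω - 1) * S) * (X / (h * (ω - 1))) * Real.log X ^ k := by field_simp
    _ ≤ _ := by
        gcongr
        linarith
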